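/- Let $\mathfrak g$ be the N=1 Bondi–Metzner–Sachs superalgebra: the complex Lie superalgebra with even basis vectors $L_n, M_n$ ($n\in\mathbb Z$), $\mathbf c_1,\mathbf c_2$, odd basis vectors $Q_r$ ($r\in\mathbb Z+\frac12$), and brackets $$[L_m,L_n]=(m-n)L_{m+n}+\tfrac{1}{12}\delta_{m+n,0}(m^3-m)\mathbf c_1,\qquad [L_m,M_n]=(m-n)M_{m+n}+\tfrac1{12}\delta_{m+n,0}(m^3-m)\mathbf c_2,$$ $$[Q_r,Q_s]=2M_{r+s}+\tfrac13\delta_{r+s,0}\left(r^2-\tfrac14\right)\mathbf c_2,\qquad [L_m,Q_r]=\left(\tfrac m2-r\right)Q_{m+r},$$ $$[M_m,M_n]=[M_n,Q_r]=0,\qquad \mathbf c_1,\mathbf c_2\ \text{central}.$$ Let $\mathfrak g_\pm$ be the span of the $L_n,M_n,Q_r$ with $\pm n>0$, $\pm r>0$, and let $\mathfrak g_0$ be the span of $L_0,M_0,\mathbf c_1,\mathbf c_2$. Let $u\mapsto\bar u$ be the linear anti-involution of $U(\mathfrak g)$ (so $\overline{uv}=\bar v\,\bar u$, without signs) with $\overline{L_n}=L_{-n}$,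 $\overline{M_n}=M_{-n}$, $\overline{Q_r}=Q_{-r}$, $\overline{\mathbf c_i}=\mathbf c_i$. The sum $U(\mathfrak g)=U(\mathfrak g_0)\oplus(\mathfrak g_-U(\mathfrak g)+U(\mathfrak g)\mathfrak g_+)$ is direct, with $U(\mathfrak g_0)$ the polynomial ring $\mathbb C[L_0,M_0,\mathbf c_1,\mathbf c_2]$; let $P:U(\mathfrak g)\to U(\mathfrak g_0)$ be the corresponding (Harish-Chandra) projection. For $h_1,h_2,c_1,c_2\in\mathbb C$ let $V$ be the Verma module of $\mathfrak g$ with highest weight vector $\mathbf 1$, where $\mathfrak g_+\mathbf 1=0$, $L_0\mathbf 1=h_1\mathbf 1$, $M_0\mathbf 1=h_2\mathbf 1$, $\mathbf c_i\mathbf 1=c_i\mathbf 1$. Let $\langle\cdot,\cdot\rangle$ be the contravariant bilinear form on $V$ given by $\langle a\mathbf 1,b\mathbf 1\rangle=\chi(P(\bar a b))$, where $\chi:U(\mathfrak g_0)\to\mathbb C$ is the character with $L_0\mapsto h_1$, $M_0\mapsto h_2$, $\mathbf c_i\mapsto c_i$. Let $\mathbb M$ be the set of finitely supported sequences $\mathbf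 i=(\dots,i_2,i_1)$ of non-negative integers and $\mathbb M_1\subset\mathbb M$ the subset of those with entries in $\{0,1\}$. Put $|\mathbf i|=\sum_n n\,i_n$ for $\mathbf i\in\mathbb M$ when it is an exponent of $L$ or $M$, and $|\mathbf k|=\sum_n (n-\frac12)k_n$ for $\mathbf k\in\mathbb M_1$ as an exponent of $Q$. Write $\mathbf i>\mathbf j$ if $i_r>j_r$ at the largest index $r$ at which they differ. For $\mathbf i,\mathbf j\in\mathbb M$, $\mathbf k\in\mathbb M_1$ let $$Q^{\mathbf k}M^{\mathbf j}L^{\mathbf i}=\cdots Q_{-2+\frac12}^{k_2}Q_{-1+\frac12}^{k_1}\cdots M_{-2}^{j_2}M_{-1}^{j_1}\cdots L_{-2}^{i_2}L_{-1}^{i_1}.$$ For $n\in\frac12\mathbb N$ (with $0\in\mathbb N$) let $S_n$ be the finite family of vectors $Q^{\mathbf k}M^{\mathbf j}L^{\mathbf i}\mathbf 1$ with $|\mathbf i|+|\mathbf j|+|\mathbf k|=n$, totally ordered by: $Q^{\mathbf k}M^{\mathbf j}L^{\mathbf i}\mathbf 1>Q^{\mathbf k'}M^{\mathbf j'}L^{\mathbf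 i'}\mathbf 1$ if and only if one of the following holds: - $|\mathbf j|>|\mathbf j'|$; - $|\mathbf j|=|\mathbf j'|$ and $\mathbf j'>\mathbf j$; - $\mathbf j=\mathbf j'$ and $|\mathbf k|>|\mathbf k'|$; - $\mathbf j=\mathbf j'$, $|\mathbf k|=|\mathbf k'|$ and $\mathbf k>\mathbf k'$; - $\mathbf j=\mathbf j'$, $\mathbf k=\mathbf k'$ and $\mathbf i>\mathbf i'$. Let $b_1>b_2>\dots>b_{p(n)}$ be the elements of $S_n$ in decreasing order, for $u=Q^{\mathbf k}M^{\mathbf j}L^{\mathbf i}\mathbf 1$ put $u^*=Q^{\mathbf k}M^{\mathbf i}L^{\mathbf j}\mathbf 1$, and let $D_n=(d_{ab})$ be the $p(n)\times p(n)$ matrix with $d_{ab}=\langle b_a,b_b^*\rangle$. **Lemma.** For every $n\in\frac12\mathbb N$ the matrix $D_n$ is lower triangular, that is, $d_{ab}=0$ for $a<b$. If $b_a=Q^{\mathbf k}M^{\mathbf j}L^{\mathbf i}\mathbf 1$, then $$d_{aa}=\prod_{r:\,i_r\ne0}i_r!\left(r\left(2h_2+\tfrac{r^2-1}{12}c_2\right)\right)^{i_r}\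 \prod_{t:\,k_t\neq0}\left(2h_2+\tfrac{4(t-\frac12)^2-1}{12}c_2\right)^{k_t}\ \prod_{s:\,j_s\ne0}j_s!\left(s\left(2h_2+\tfrac{s^2-1}{12}c_2\right)\right)^{j_s}.$$ Consequently $\det D_n=\prod_{a=1}^{p(n)}d_{aa}$ is the product of these expressions over all elements of $S_n$. -/

import Mathlib

noncomputable section

namespace BMS

/-! ### The N=1 BMS superalgebra -/

/-- The basis of the N=1 BMS superalgebra: `L n`, `M n` for `n : ℤ`, the odd elements
`Q_{k+1/2}` (written `Q k`, so that `k : ℤ` runs over all half-odd modes) and the central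
elements `c₁`, `c₂`. -/
inductive Gen
  | L (n : ℤ)
  | M (n : ℤ)
  | Q (k : ℤ)
  | c₁
  | c₂

/-- The underlying vector space of the N=1 BMS superalgebra. -/
abbrev Alg : Type := Gen →₀ ℂ

/-- The basis vector of the superalgebra attached to a label. -/
def e (x : Gen) : Alg := Finsupp.single x 1

/-- `[L_m, L_n] = (m - n) L_{m+n} + δ_{m+n,0} (m³ - m)/12 c₁`. -/
def brLL (m n : ℤ) : Alg :=
  ((m : ℂ) - n) • e (.L (m + n)) + (if m + n = 0 then ((m : ℂ) ^ 3 - m) / 12 else 0) • e .c₁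

/-- `[L_m, M_n] = (m - n) M_{m+n} + δ_{m+n,0} (m³ - m)/12 c₂`. -/
def brLM (m n : ℤ) : Alg :=
  ((m : ℂ) - n) • e (.M (m + n)) + (if m + n = 0 then ((m : ℂ) ^ 3 - m) / 12 else 0) • e .c₂

/-- `[L_m, Q_r] = (m/2 - r) Q_{m+r}` with `r = k + 1/2`. -/
def brLQ (m k : ℤ) : Alg :=
  ((m : ℂ) / 2 - ((k : ℂ) + 1 / 2)) • e (.Q (m + k))

/-- `[Q_r, Q_s] = 2 M_{r+s} + δ_{r+s,0} (r² - 1/4)/3 c₂` with `r = k + 1/2`, `s = l + 1/2`. -/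
def brQQ (k l : ℤ) : Alg :=
  (2 : ℂ) • e (.M (k + l + 1)) +
    (if k + l + 1 = 0 then (((k : ℂ) + 1 / 2) ^ 2 - 1 / 4) / 3 else 0) • e .c₂

/-- The super bracket of two basis vectors. -/
def bracket : Gen → Gen → Alg
  | .L m, .L n => brLL m n
  | .L m, .M n => brLM m n
  | .M m, .L n => -brLM n m
  | .L m, .Q k => brLQ m k
  | .Q k, .L m => -brLQ m k
  | .Q k, .Q l => brQQ k l
  | _, _ => 0

/-- The Koszul sign `(-1)^{|x||y|}`: it is `-1` exactly when both basis vectors are odd. -/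
def koszul : Gen → Gen → ℂ
  | .Q _, .Q _ => -1
  | _, _ => 1

/-! ### The universal enveloping algebra -/

/-- The linear inclusion of the superalgebra in the free associative algebra on its basis
(the tensor algebra of the superalgebra). -/
def freeIncl : Alg →ₗ[ℂ] FreeAlgebra ℂ Gen :=
  Finsupp.linearCombination ℂ (FreeAlgebra.ι ℂ)

/-- The defining relations `x y = (-1)^{|x||y|} y x + [x, y]` of the enveloping algebra. -/
inductive Rel : FreeAlgebra ℂ Gen → FreeAlgebra ℂ Gen → Prop
  | mk (x y : Gen) :
      Rel (FreeAlgebra.ι ℂ x * FreeAlgebra.ι ℂ y)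
        (koszul x y • (FreeAlgebra.ι ℂ y * FreeAlgebra.ι ℂ x) + freeIncl (bracket x y))

/-- The universal enveloping algebra `U(𝔤)` of the N=1 BMS superalgebra. -/
def U : Type := RingQuot Rel

instance : Ring U := inferInstanceAs (Ring (RingQuot Rel))

instance : Algebra ℂ U := inferInstanceAs (Algebra ℂ (RingQuot Rel))

/-- The quotient map from the free algebra. -/
def mk : FreeAlgebra ℂ Gen →ₐ[ℂ] U := RingQuot.mkAlgHom ℂ Rel

/-- The image in `U(𝔤)` of a basis vector. -/
def g (x : Gen) : U := mk (FreeAlgebra.ι ℂ x)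

/-- The linear map `𝔤 → U(𝔤)`. -/
def incl : Alg →ₗ[ℂ] U := Finsupp.linearCombination ℂ g

@[simp] theorem incl_e (x : Gen) : incl (e x) = g x := by
  simp [incl, e]

theorem mk_freeIncl (a : Alg) : mk (freeIncl a) = incl a := by
  have h : mk.toLinearMap ∘ₗ freeIncl = incl := by
    ext x
    simp [freeIncl, incl, g]
  exact LinearMap.congr_fun h a

theorem g_mul (x y : Gen) : g x * g y = koszul x y • (g y * g x) + incl (bracket x y) := by
  have h : mk _ = mk _ := RingQuot.mkAlgHom_rel ℂ (Rel.mk x y)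
  simpa [g, mk_freeIncl] using h

/-! ### The anti-involution -/

/-- `L_n ↦ L_{-n}`, `M_n ↦ M_{-n}`, `Q_r ↦ Q_{-r}`, `c_i ↦ c_i` on the basis. -/
def bar : Gen → Gen
  | .L n => .L (-n)
  | .M n => .M (-n)
  | .Q k => .Q (-k - 1)
  | .c₁ => .c₁
  | .c₂ => .c₂

theorem incl_bracket_bar (x y : Gen) :
    incl (bracket (bar y) (bar x)) = Finsupp.linearCombination ℂ (fun z => g (bar z)) (bracket x y)
      := by
  obtain ⟨f, hf⟩ : ∃ f, f = Finsupp.linearCombination ℂ (fun z => g (bar z)) := ⟨_, rfl⟩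
  have key : ∀ z, f (e z) = g (bar z) := by
    intro z; simp [hf, e]
  rw [← hf]
  clear hf
  cases x <;> cases y <;>
    simp only [bracket, bar, brLL, brLM, brLQ, brQQ, map_add, map_neg, map_smul, key, incl_e,
      map_zero]
  case L.L m n =>
    rw [show -n + -m = -(m + n) by ring]
    by_cases h : m + n = 0
    · obtain rfl : n = -m := by omega
      simp
    · have h' : -(m + n) ≠ 0 := by omega
      simp only [h, h', if_false]
      push_cast; module
  case L.M m n =>
    rw [show -m + -n = -(m + n) by ring]
    by_cases h : m + n = 0
    · obtain rfl : n = -m := by omega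
      simp; module
    · have h' : -(m + n) ≠ 0 := by omega
      simp only [h, h', if_false]
      push_cast; module
  case M.L m n =>
    rw [show -n + -m = -(n + m) by ring]
    by_cases h : n + m = 0
    · obtain rfl : n = -m := by omega
      simp; module
    · have h' : -(n + m) ≠ 0 := by omega
      simp only [h, h', if_false]
      push_cast; module
  case L.Q m k =>
    rw [show -m + (-k - 1) = -(m + k) - 1 by ring]
    push_cast; module
  case Q.L k m =>
    rw [show -m + (-k - 1) = -(m + k) - 1 by ring]
    push_cast; module
  case Q.Q k l =>
    rw [show -l - 1 + (-k - 1) + 1 = -(k + l + 1) by ring]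
    by_cases h : k + l + 1 = 0
    · obtain rfl : l = -k - 1 := by omega
      simp [h]
    · have h' : -(k + l + 1) ≠ 0 := by omega
      simp only [h, h', if_false]

theorem koszul_bar (x y : Gen) : koszul (bar y) (bar x) = koszul x y := by
  cases x <;> cases y <;> rfl

/-- The homomorphism from the free algebra to the opposite of `U(𝔤)` given by `bar`. -/
def freeAnti : FreeAlgebra ℂ Gen →ₐ[ℂ] Uᵐᵒᵖ :=
  FreeAlgebra.lift ℂ (fun x => MulOpposite.op (g (bar x)))

theorem freeAnti_rel ⦃a b : FreeAlgebra ℂ Gen⦄ (h : Rel a b) : freeAnti a = freeAnti b := by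
  obtain ⟨x, y⟩ := h
  have h1 : ∀ a : Alg, freeAnti (freeIncl a)
      = MulOpposite.op (Finsupp.linearCombination ℂ (fun z => g (bar z)) a) := by
    intro a
    induction a using Finsupp.induction_linear with
    | zero => simp
    | add f g hf hg => simp [hf, hg]
    | single z c => simp [freeIncl, freeAnti]
  have h2 : ∀ z, freeAnti (FreeAlgebra.ι ℂ z) = MulOpposite.op (g (bar z)) := fun z => by
    simp [freeAnti]
  simp only [map_mul, map_add, map_smul, h2, h1, ← MulOpposite.op_mul,
    ← MulOpposite.op_smul, ← MulOpposite.op_add]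
  rw [← incl_bracket_bar, g_mul, koszul_bar]

/-- The anti-involution of `U(𝔤)`, as a homomorphism to the opposite algebra. -/
def antiHom : U →ₐ[ℂ] Uᵐᵒᵖ := RingQuot.liftAlgHom ℂ ⟨freeAnti, freeAnti_rel⟩

theorem antiHom_mk (a : FreeAlgebra ℂ Gen) : antiHom (mk a) = freeAnti a :=
  RingQuot.liftAlgHom_mkAlgHom_apply ℂ freeAnti freeAnti_rel a

/-- The anti-involution `u ↦ ū` of `U(𝔤)`: the linear map with `(u v)‾ = v̄ ū` that extends
`bar`. -/
def anti : U →ₗ[ℂ] U :=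
  (MulOpposite.opLinearEquiv ℂ).symm.toLinearMap ∘ₗ antiHom.toLinearMap

@[simp] theorem anti_mul (u v : U) : anti (u * v) = anti v * anti u := by
  simp [anti]

@[simp] theorem anti_one : anti 1 = 1 := by
  simp [anti]

@[simp] theorem anti_g (x : Gen) : anti (g x) = g (bar x) := by
  simp [anti, g, antiHom_mk, freeAnti]

/-! ### The triangular decomposition and the Harish-Chandra projection -/

/-- The basis of `𝔤₊`. -/
def IsPos : Gen → Prop
  | .L n => 0 < n
  | .M n => 0 < n
  | .Q k => 0 ≤ k
  | _ => False

/-- The basis of `𝔤₋`. -/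
def IsNeg : Gen → Prop
  | .L n => n < 0
  | .M n => n < 0
  | .Q k => k < 0
  | _ => False

/-- The basis `L₀, M₀, c₁, c₂` of the abelian algebra `𝔤₀`. -/
def cartan : Fin 4 → Gen := ![.L 0, .M 0, .c₁, .c₂]

/-- `U(𝔤₀)`: since `𝔤₀` is abelian and even, it is the polynomial ring on its basis. -/
abbrev U₀ : Type := MvPolynomial (Fin 4) ℂ

/-- The element `L₀^{a 0} M₀^{a 1} c₁^{a 2} c₂^{a 3}` of `U(𝔤)`. -/
def cartanMonomial (a : Fin 4 → ℕ) : U :=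
  g (cartan 0) ^ a 0 * g (cartan 1) ^ a 1 * g (cartan 2) ^ a 2 * g (cartan 3) ^ a 3

/-- `P : U(𝔤) → U(𝔤₀)` is the projection along the decomposition
`U(𝔤) = U(𝔤₀) ⊕ (𝔤₋ U(𝔤) + U(𝔤) 𝔤₊)`: it is linear, the identity on `U(𝔤₀)`, and it kills
`𝔤₋ U(𝔤)` and `U(𝔤) 𝔤₊`. -/
structure IsHarishChandra (P : U →ₗ[ℂ] U₀) : Prop where
  id_on : ∀ a : Fin 4 → ℕ, P (cartanMonomial a) = ∏ i, MvPolynomial.X i ^ a i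
  neg_mul : ∀ x, IsNeg x → ∀ u, P (g x * u) = 0
  mul_pos : ∀ u x, IsPos x → P (u * g x) = 0

open Classical in
/-- The Harish-Chandra projection of `U(𝔤)` on `U(𝔤₀)`: the unique map with the property above.
(The value `0` is a placeholder for the case, ruled out by the PBW theorem, that there is none.) -/
def harishChandra : U →ₗ[ℂ] U₀ :=
  if h : ∃ P, IsHarishChandra P then h.choose else 0

/-- The values at `L₀, M₀, c₁, c₂` of the weight `(h₁, h₂, c₁, c₂)`. -/
def weight (h₁ h₂ c₁ c₂ : ℂ) : Fin 4 → ℂ := ![h₁, h₂, c₁, c₂]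

/-- The linear form `u ↦ ⟨𝟏, P(u) 𝟏⟩` on `U(𝔤)`: the value of the Harish-Chandra projection at
the weight `lam`. -/
def vac (lam : Fin 4 → ℂ) : U →ₗ[ℂ] ℂ :=
  (MvPolynomial.aeval lam).toLinearMap ∘ₗ harishChandra

/-! ### The Verma module -/

/-- The left ideal of `U(𝔤)` generated by `𝔤₊` and by `x - lam(x)` for `x` in `𝔤₀`. -/
def vermaIdeal (lam : Fin 4 → ℂ) : Submodule U U :=
  Submodule.span U
    ({u | ∃ x, IsPos x ∧ u = g x} ∪ {u | ∃ i, u = g (cartan i) - algebraMap ℂ U (lam i)})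

/-- The Verma module `U(𝔤) ⊗_{U(𝔤₀ ⊕ 𝔤₊)} ℂ`, as the quotient of `U(𝔤)` by the left ideal that
annihilates its highest weight vector. -/
abbrev Verma (lam : Fin 4 → ℂ) : Type := U ⧸ vermaIdeal lam

/-- The highest weight vector `𝟏 = 1 ⊗ 1`. -/
def vacuum (lam : Fin 4 → ℂ) : Verma lam := Submodule.Quotient.mk 1

/-! ### Helper facts: the form descends to the Verma module -/

/-- The span of the words of length at most `n` in the basis. -/
def fil (n : ℕ) : Submodule ℂ U :=
  Submodule.span ℂ {u | ∃ l : List Gen, l.length ≤ n ∧ u = (l.map g).prod}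

theorem fil_mono {m n : ℕ} (h : m ≤ n) : fil m ≤ fil n :=
  Submodule.span_mono fun _ ⟨l, hl, e⟩ => ⟨l, hl.trans h, e⟩

theorem prod_mem_fil (l : List Gen) : (l.map g).prod ∈ fil l.length :=
  Submodule.subset_span ⟨l, le_rfl, rfl⟩

theorem fil_mul {m n : ℕ} {u v : U} (hu : u ∈ fil m) (hv : v ∈ fil n) : u * v ∈ fil (m + n) := by
  have h : u * v ∈ fil m * fil n := Submodule.mul_mem_mul hu hv
  rw [fil, fil, Submodule.span_mul_span] at h
  refine Submodule.span_mono ?_ h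
  rintro _ ⟨_, ⟨l, hl, rfl⟩, _, ⟨l', hl', rfl⟩, rfl⟩
  exact ⟨l ++ l', by simp; omega, by simp⟩

theorem g_mem_fil (x : Gen) : g x ∈ fil 1 := by
  simpa using prod_mem_fil [x]

theorem incl_mem_fil (a : Alg) : incl a ∈ fil 1 := by
  induction a using Finsupp.induction_linear with
  | zero => simp
  | add f h hf hh => simpa using add_mem hf hh
  | single z c => simpa [incl] using Submodule.smul_mem _ c (g_mem_fil z)

theorem exists_mem_fil (u : U) : ∃ n, u ∈ fil n := by
  obtain ⟨a, rfl⟩ : ∃ a, mk a = u := RingQuot.mkAlgHom_surjective ℂ Rel u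
  induction a using FreeAlgebra.induction with
  | grade0 r =>
    refine ⟨0, ?_⟩
    have := Submodule.smul_mem _ r (prod_mem_fil [])
    simpa [Algebra.algebraMap_eq_smul_one] using this
  | grade1 x => exact ⟨1, g_mem_fil x⟩
  | mul a b ha hb =>
    obtain ⟨m, hm⟩ := ha
    obtain ⟨n, hn⟩ := hb
    exact ⟨m + n, by simpa using fil_mul hm hn⟩
  | add a b ha hb =>
    obtain ⟨m, hm⟩ := ha
    obtain ⟨n, hn⟩ := hb
    exact ⟨max m n, by
      simpa using add_mem (fil_mono (le_max_left m n) hm) (fil_mono (le_max_right m n) hn)⟩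

theorem move_front (x : Gen) (l : List Gen) :
    ∃ s : ℂ, (l.map g).prod * g x - s • (g x * (l.map g).prod) ∈ fil l.length := by
  induction l with
  | nil => exact ⟨1, by simp⟩
  | cons y l ih =>
    obtain ⟨s, hs⟩ := ih
    refine ⟨s * koszul y x, ?_⟩
    have h1 := fil_mul (g_mem_fil y) hs
    have h2 := Submodule.smul_mem _ s (fil_mul (incl_mem_fil (bracket y x)) (prod_mem_fil l))
    have h3 := add_mem h1 h2
    rw [List.length_cons, add_comm]
    convert h3 using 1
    have h4 : g y * (g x * (l.map g).prod) =
        koszul y x • (g x * (g y * (l.map g).prod)) + incl (bracket y x) * (l.map g).prod := by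
      rw [← mul_assoc, g_mul, add_mul, smul_mul_assoc, mul_assoc]
    simp only [List.map_cons, List.prod_cons, mul_sub, mul_smul_comm, h4, mul_assoc]
    module

theorem move_back (x : Gen) (l : List Gen) :
    ∃ s : ℂ, g x * (l.map g).prod - s • ((l.map g).prod * g x) ∈ fil l.length := by
  induction l with
  | nil => exact ⟨1, by simp⟩
  | cons y l ih =>
    obtain ⟨s, hs⟩ := ih
    refine ⟨s * koszul x y, ?_⟩
    have h1 := Submodule.smul_mem _ (koszul x y) (fil_mul (g_mem_fil y) hs)
    have h2 := fil_mul (incl_mem_fil (bracket x y)) (prod_mem_fil l)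
    have h3 := add_mem h1 h2
    rw [List.length_cons, add_comm]
    convert h3 using 1
    have h4 : g x * (g y * (l.map g).prod) =
        koszul x y • (g y * (g x * (l.map g).prod)) + incl (bracket x y) * (l.map g).prod := by
      rw [← mul_assoc, g_mul, add_mul, smul_mul_assoc, mul_assoc]
    simp only [List.map_cons, List.prod_cons, mul_sub, mul_smul_comm, h4, mul_assoc]
    module

theorem cartan_comm (i j : Fin 4) : g (cartan i) * g (cartan j) = g (cartan j) * g (cartan i) := by
  rw [g_mul]
  fin_cases i <;> fin_cases j <;> simp [cartan, koszul, bracket, brLL, brLM]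

theorem cartanMonomial_mul (a : Fin 4 → ℕ) (i : Fin 4) :
    cartanMonomial a * g (cartan i) = cartanMonomial (a + Pi.single i 1) := by
  have h : ∀ i j n, g (cartan j) ^ n * g (cartan i) = g (cartan i) * g (cartan j) ^ n :=
    fun i j n => (Commute.pow_right (cartan_comm i j) n).eq.symm
  have h' : ∀ i j n (u : U), g (cartan j) ^ n * (g (cartan i) * u)
      = g (cartan i) * (g (cartan j) ^ n * u) := by
    intro i j n u
    rw [← mul_assoc, h, mul_assoc]
  fin_cases i <;>
    simp [cartanMonomial, pow_succ, mul_assoc, h, h']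

/-- The spanning set of the triangular decomposition. -/
def triSet : Set U :=
  Set.range cartanMonomial ∪ ({u | ∃ x v, IsNeg x ∧ u = g x * v} ∪ {u | ∃ x v, IsPos x ∧ u = v * g x})

theorem cartan_of_not (x : Gen) (h₁ : ¬ IsNeg x) (h₂ : ¬ IsPos x) : ∃ i, x = cartan i := by
  cases x with
  | L n => exact ⟨0, by simp only [IsNeg, IsPos] at *; simp [cartan]; omega⟩
  | M n => exact ⟨1, by simp only [IsNeg, IsPos] at *; simp [cartan]; omega⟩
  | Q k => simp only [IsNeg, IsPos] at *; omega
  | c₁ => exact ⟨2, rfl⟩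
  | c₂ => exact ⟨3, rfl⟩

theorem mem_span_triSet (u : U) : u ∈ Submodule.span ℂ triSet := by
  obtain ⟨n, hn⟩ := exists_mem_fil u
  suffices h : ∀ n, fil n ≤ Submodule.span ℂ triSet from h n hn
  clear hn u n
  intro n
  induction n with
  | zero =>
    refine Submodule.span_le.2 ?_
    rintro _ ⟨l, hl, rfl⟩
    obtain rfl : l = [] := by simpa using hl
    exact Submodule.subset_span (Or.inl ⟨0, by simp [cartanMonomial]⟩)
  | succ n ih =>
    refine Submodule.span_le.2 ?_
    rintro _ ⟨l, hl, rfl⟩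
    by_cases h₁ : ∃ x ∈ l, IsNeg x
    · obtain ⟨x, hx, hx'⟩ := h₁
      obtain ⟨l₁, l₂, rfl⟩ := List.append_of_mem hx
      obtain ⟨s, hs⟩ := move_front x l₁
      have h3 := ih (fil_mono (by simp at hl; omega) (fil_mul hs (prod_mem_fil l₂)))
      have h4 : g x * (s • ((l₁.map g).prod * (l₂.map g).prod)) ∈ Submodule.span ℂ triSet :=
        Submodule.subset_span (Or.inr (Or.inl ⟨x, _, hx', rfl⟩))
      convert add_mem h3 h4 using 1
      simp [sub_mul, mul_assoc]
    by_cases h₂ : ∃ x ∈ l, IsPos x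
    · obtain ⟨x, hx, hx'⟩ := h₂
      obtain ⟨l₁, l₂, rfl⟩ := List.append_of_mem hx
      obtain ⟨s, hs⟩ := move_back x l₂
      have h3 := ih (fil_mono (by simp at hl; omega) (fil_mul (prod_mem_fil l₁) hs))
      have h4 : (s • ((l₁.map g).prod * (l₂.map g).prod)) * g x ∈ Submodule.span ℂ triSet :=
        Submodule.subset_span (Or.inr (Or.inr ⟨x, _, hx', rfl⟩))
      convert add_mem h3 h4 using 1
      simp [mul_sub, mul_assoc]
    push Not at h₁ h₂
    refine Submodule.subset_span (Or.inl ?_)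
    clear hl ih
    induction l using List.reverseRecOn with
    | nil => exact ⟨0, by simp [cartanMonomial]⟩
    | append_singleton l x ih =>
      obtain ⟨a, ha⟩ := ih (fun y hy => h₁ y (by simp [hy])) (fun y hy => h₂ y (by simp [hy]))
      obtain ⟨i, rfl⟩ := cartan_of_not x (h₁ x (by simp)) (h₂ x (by simp))
      exact ⟨a + Pi.single i 1, by rw [← cartanMonomial_mul, ha]; simp⟩

theorem cartan_mul_cartanMonomial (a : Fin 4 → ℕ) (i : Fin 4) :
    g (cartan i) * cartanMonomial a = cartanMonomial (a + Pi.single i 1) := by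
  rw [← cartanMonomial_mul]
  have h : ∀ j n, Commute (g (cartan i)) (g (cartan j) ^ n) := fun j n =>
    Commute.pow_right (cartan_comm i j) n
  exact (((h _ _).mul_right (h _ _)).mul_right (h _ _)).mul_right (h _ _)

theorem cartan_normalizes (x : Gen) (hx : IsNeg x ∨ IsPos x) (i : Fin 4) :
    ∃ (s : ℂ) (y : Gen), (IsNeg x → IsNeg y) ∧ (IsPos x → IsPos y) ∧
      g x * g (cartan i) = g (cartan i) * g x + s • g y := by
  cases x with
  | L n =>
    have hn : n ≠ 0 := by rintro rfl; simp [IsNeg, IsPos] at hx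
    fin_cases i
    · exact ⟨n, .L n, id, id, by rw [g_mul]; simp [cartan, koszul, bracket, brLL, hn]⟩
    · exact ⟨n, .M n, id, id, by rw [g_mul]; simp [cartan, koszul, bracket, brLM, hn]⟩
    · exact ⟨0, .L n, id, id, by rw [g_mul]; simp [cartan, koszul, bracket]⟩
    · exact ⟨0, .L n, id, id, by rw [g_mul]; simp [cartan, koszul, bracket]⟩
  | M n =>
    have hn : n ≠ 0 := by rintro rfl; simp [IsNeg, IsPos] at hx
    fin_cases i
    · exact ⟨n, .M n, id, id, by rw [g_mul]; simp [cartan, koszul, bracket, brLM, hn]⟩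
    · exact ⟨0, .M n, id, id, by rw [g_mul]; simp [cartan, koszul, bracket]⟩
    · exact ⟨0, .M n, id, id, by rw [g_mul]; simp [cartan, koszul, bracket]⟩
    · exact ⟨0, .M n, id, id, by rw [g_mul]; simp [cartan, koszul, bracket]⟩
  | Q k =>
    fin_cases i
    · exact ⟨k + 1 / 2, .Q k, id, id, by
        rw [g_mul]; simp [cartan, koszul, bracket, brLQ, -neg_smul]; module⟩
    · exact ⟨0, .Q k, id, id, by rw [g_mul]; simp [cartan, koszul, bracket]⟩
    · exact ⟨0, .Q k, id, id, by rw [g_mul]; simp [cartan, koszul, bracket]⟩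
    · exact ⟨0, .Q k, id, id, by rw [g_mul]; simp [cartan, koszul, bracket]⟩
  | c₁ => simp [IsNeg, IsPos] at hx
  | c₂ => simp [IsNeg, IsPos] at hx

theorem prod_X_pow_add (a : Fin 4 → ℕ) (i : Fin 4) :
    ∏ j, (MvPolynomial.X j : U₀) ^ (a + Pi.single i 1 : Fin 4 → ℕ) j =
      (∏ j, (MvPolynomial.X j : U₀) ^ a j) * MvPolynomial.X i := by
  simp only [Pi.add_apply, pow_add, Finset.prod_mul_distrib]
  congr 1
  rw [Finset.prod_eq_single i] <;> simp +contextual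

theorem IsHarishChandra.mul_cartan {P : U →ₗ[ℂ] U₀} (hP : IsHarishChandra P) (u : U) (i : Fin 4) :
    P (u * g (cartan i)) = P u * MvPolynomial.X i := by
  induction mem_span_triSet u using Submodule.span_induction with
  | zero => simp
  | add u v _ _ hu hv => simp [add_mul, hu, hv]
  | smul c u _ hu => simp [hu]
  | mem u hu =>
    rcases hu with ⟨a, rfl⟩ | ⟨x, v, hx, rfl⟩ | ⟨x, v, hx, rfl⟩
    · rw [cartanMonomial_mul, hP.id_on, hP.id_on]
      exact prod_X_pow_add a i
    · rw [mul_assoc, hP.neg_mul x hx, hP.neg_mul x hx, zero_mul]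
    · obtain ⟨s, y, -, hy, hs⟩ := cartan_normalizes x (Or.inr hx) i
      have h : v * g x * g (cartan i) = (v * g (cartan i)) * g x + s • (v * g y) := by
        rw [mul_assoc, hs, mul_add, mul_assoc, mul_smul_comm]
      rw [h, map_add, map_smul, hP.mul_pos _ x hx, hP.mul_pos _ x hx, hP.mul_pos _ y (hy hx)]
      simp

theorem IsHarishChandra.cartan_mul {P : U →ₗ[ℂ] U₀} (hP : IsHarishChandra P) (u : U) (i : Fin 4) :
    P (g (cartan i) * u) = P u * MvPolynomial.X i := by
  induction mem_span_triSet u using Submodule.span_induction with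
  | zero => simp
  | add u v _ _ hu hv => simp [add_mul, mul_add, hu, hv]
  | smul c u _ hu => simp [hu]
  | mem u hu =>
    rcases hu with ⟨a, rfl⟩ | ⟨x, v, hx, rfl⟩ | ⟨x, v, hx, rfl⟩
    · rw [cartan_mul_cartanMonomial, hP.id_on, hP.id_on]
      exact prod_X_pow_add a i
    · obtain ⟨s, y, hy, -, hs⟩ := cartan_normalizes x (Or.inl hx) i
      have h : g (cartan i) * (g x * v) = g x * (g (cartan i) * v) - s • (g y * v) := by
        rw [← mul_assoc, eq_sub_of_add_eq hs.symm, sub_mul, mul_assoc, smul_mul_assoc]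
      rw [h, map_sub, map_smul, hP.neg_mul x hx, hP.neg_mul x hx, hP.neg_mul y (hy hx)]
      simp
    · rw [← mul_assoc, hP.mul_pos _ x hx, hP.mul_pos _ x hx, zero_mul]

/-- There is at most one such projection. -/
theorem IsHarishChandra.unique {P P' : U →ₗ[ℂ] U₀} (hP : IsHarishChandra P)
    (hP' : IsHarishChandra P') : P = P' := by
  refine LinearMap.ext fun u => ?_
  induction mem_span_triSet u using Submodule.span_induction with
  | zero => simp
  | add u v _ _ hu hv => simp [hu, hv]
  | smul c u _ hu => simp [hu]
  | mem u hu =>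
    rcases hu with ⟨a, rfl⟩ | ⟨x, v, hx, rfl⟩ | ⟨x, v, hx, rfl⟩
    · rw [hP.id_on, hP'.id_on]
    · rw [hP.neg_mul x hx, hP'.neg_mul x hx]
    · rw [hP.mul_pos v x hx, hP'.mul_pos v x hx]

theorem harishChandra_cases : IsHarishChandra harishChandra ∨ harishChandra = 0 := by
  classical
  unfold harishChandra
  split_ifs with h
  · exact Or.inl h.choose_spec
  · exact Or.inr rfl

theorem isPos_iff_bar (x : Gen) : IsNeg (bar x) ↔ IsPos x := by
  cases x <;> simp [IsNeg, IsPos, bar]; try omega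

theorem bar_cartan (i : Fin 4) : bar (cartan i) = cartan i := by
  fin_cases i <;> simp [bar, cartan]

theorem vac_mul_mem (lam : Fin 4 → ℂ) (u v : U) (hv : v ∈ vermaIdeal lam) :
    vac lam (u * v) = 0 := by
  rcases harishChandra_cases with hP | hP
  swap
  · simp [vac, hP]
  induction hv using Submodule.span_induction generalizing u with
  | zero => simp
  | add v w _ _ hv hw => simp [mul_add, hv, hw]
  | smul c v _ hv => simpa [mul_assoc] using hv (u * c)
  | mem v hv =>
    rcases hv with ⟨x, hx, rfl⟩ | ⟨i, rfl⟩
    · simp [vac, hP.mul_pos u x hx]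
    · simp [vac, mul_sub, hP.mul_cartan, ← Algebra.commutes, ← Algebra.smul_def, mul_comm]

theorem vac_anti_mem_mul (lam : Fin 4 → ℂ) (u v : U) (hv : v ∈ vermaIdeal lam) :
    vac lam (anti v * u) = 0 := by
  rcases harishChandra_cases with hP | hP
  swap
  · simp [vac, hP]
  induction hv using Submodule.span_induction generalizing u with
  | zero => simp
  | add v w _ _ hv hw => simp [add_mul, hv, hw]
  | smul c v _ hv => simpa [mul_assoc] using hv (anti c * u)
  | mem v hv =>
    rcases hv with ⟨x, hx, rfl⟩ | ⟨i, rfl⟩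
    · simp [vac, hP.neg_mul (bar x) ((isPos_iff_bar x).2 hx) u]
    · simp [vac, sub_mul, hP.cartan_mul, bar_cartan, Algebra.algebraMap_eq_smul_one, mul_comm]

/-! ### The contravariant form -/

/-- The bilinear form `(a, b) ↦ ⟨𝟏, P(ā b) 𝟏⟩` on `U(𝔤)`. -/
def preForm (lam : Fin 4 → ℂ) : U →ₗ[ℂ] U →ₗ[ℂ] ℂ :=
  ((LinearMap.mul ℂ U).compr₂ (vac lam)) ∘ₗ anti

/-- A linear map on `U(𝔤)` that kills the left ideal, as a linear map on the Verma module. -/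
def descend (lam : Fin 4 → ℂ) {V : Type} [AddCommGroup V] [Module ℂ V] (f : U →ₗ[ℂ] V)
    (hf : ∀ v ∈ vermaIdeal lam, f v = 0) : Verma lam →ₗ[ℂ] V :=
  ((vermaIdeal lam).restrictScalars ℂ).liftQ f (fun v hv => hf v hv) ∘ₗ
    (Submodule.Quotient.restrictScalarsEquiv ℂ (vermaIdeal lam)).symm.toLinearMap

@[simp] theorem descend_mk (lam : Fin 4 → ℂ) {V : Type} [AddCommGroup V] [Module ℂ V]
    (f : U →ₗ[ℂ] V) (hf : ∀ v ∈ vermaIdeal lam, f v = 0) (u : U) :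
    descend lam f hf (Submodule.Quotient.mk u) = f u := rfl

/-- The form on the Verma module in its second argument, for a first argument in `U(𝔤)`. -/
def halfForm (lam : Fin 4 → ℂ) : U →ₗ[ℂ] Verma lam →ₗ[ℂ] ℂ where
  toFun a := descend lam (preForm lam a) (fun v hv => vac_mul_mem lam (anti a) v hv)
  map_add' a b := by
    refine LinearMap.ext fun v => ?_
    induction v using Submodule.Quotient.induction_on with
    | H v => exact LinearMap.congr_fun ((preForm lam).map_add a b) v
  map_smul' c a := by
    refine LinearMap.ext fun v => ?_
    induction v using Submodule.Quotient.induction_on with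
    | H v => exact LinearMap.congr_fun ((preForm lam).map_smul c a) v

/-- The contravariant form on the Verma module: `⟨a𝟏, b𝟏⟩ = ⟨𝟏, P(ā b) 𝟏⟩`. -/
def form (lam : Fin 4 → ℂ) : Verma lam →ₗ[ℂ] Verma lam →ₗ[ℂ] ℂ :=
  descend lam (halfForm lam) (fun v hv => by
    refine LinearMap.ext fun w => ?_
    induction w using Submodule.Quotient.induction_on with
    | H w => exact vac_anti_mem_mul lam w v hv)

theorem form_apply (lam : Fin 4 → ℂ) (a b : U) :
    form lam (a • vacuum lam) (b • vacuum lam) = vac lam (anti a * b) := by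
  have h : ∀ a : U, a • vacuum lam = Submodule.Quotient.mk a := fun a => by
    rw [vacuum, ← Submodule.Quotient.mk_smul, smul_eq_mul, mul_one]
  rw [h, h]
  rfl

/-! ### Exponent vectors and their order -/

/-- The set `𝕄` of finitely supported exponent vectors `(…, i₂, i₁)`. -/
abbrev Expo : Type := ℕ+ →₀ ℕ

/-- `|i| = ∑ n · i_n`. -/
def size (i : Expo) : ℚ := i.sum fun n a => (a : ℚ) * (n : ℕ)

/-- `|k| = ∑ (n - 1/2) · k_n`. -/
def sizeQ (k : Expo) : ℚ := k.sum fun n a => (a : ℚ) * ((n : ℕ) - 1 / 2)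

/-- The lexicographical order on `𝕄`: `i > j` if `i_r > j_r` at the largest index `r` at which
they differ. -/
def LexGT (i j : Expo) : Prop := ∃ r, j r < i r ∧ ∀ s, r < s → i s = j s

/-- The triples `(i, j, k)` in `𝕄 × 𝕄 × 𝕄₁` that label the vectors `Q^k M^j L^i 𝟏`. -/
@[ext] structure Index where
  /-- the exponents of the `L_{-n}` -/
  i : Expo
  /-- the exponents of the `M_{-n}` -/
  j : Expo
  /-- the exponents of the `Q_{-n+1/2}` -/
  k : Expo
  k_le_one : ∀ n, k n ≤ 1

/-- The length `w(i, j, k)`. -/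
def Index.length (x : Index) : ℚ := size x.i + size x.j + sizeQ x.k

/-- The principal order `x > y` on the labels. -/
def PrincipalGT (x y : Index) : Prop :=
  size y.j < size x.j ∨
  (size x.j = size y.j ∧ LexGT y.j x.j) ∨
  (x.j = y.j ∧ sizeQ y.k < sizeQ x.k) ∨
  (x.j = y.j ∧ sizeQ x.k = sizeQ y.k ∧ LexGT x.k y.k) ∨
  (x.j = y.j ∧ x.k = y.k ∧ LexGT x.i y.i)

theorem lexGT_irrefl (i : Expo) : ¬ LexGT i i := fun ⟨_, h, _⟩ => lt_irrefl _ h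

theorem lexGT_trans {i j k : Expo} (h : LexGT i j) (h' : LexGT j k) : LexGT i k := by
  obtain ⟨r, hr, hr'⟩ := h
  obtain ⟨s, hs, hs'⟩ := h'
  rcases lt_trichotomy r s with h | rfl | h
  · exact ⟨s, by rw [hr' s h]; exact hs, fun t ht => (hr' t (h.trans ht)).trans (hs' t ht)⟩
  · exact ⟨r, hs.trans hr, fun t ht => (hr' t ht).trans (hs' t ht)⟩
  · exact ⟨r, by rw [← hs' r h]; exact hr, fun t ht => (hr' t ht).trans (hs' t (h.trans ht))⟩

theorem lexGT_total (i j : Expo) : LexGT i j ∨ i = j ∨ LexGT j i := by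
  by_cases h : i = j
  · exact Or.inr (Or.inl h)
  have hne : (Finset.filter (fun n => i n ≠ j n) (i.support ∪ j.support)).Nonempty := by
    obtain ⟨n, hn⟩ := Finsupp.ne_iff.1 h
    refine ⟨n, ?_⟩
    simp only [Finset.mem_filter, Finset.mem_union, Finsupp.mem_support_iff]
    omega
  set r := Finset.max' _ hne with hr
  have h1 := Finset.max'_mem _ hne
  rw [← hr, Finset.mem_filter] at h1
  have h2 : ∀ s, r < s → i s = j s := by
    intro s hs
    by_contra hc
    have hs' : s ∈ Finset.filter (fun n => i n ≠ j n) (i.support ∪ j.support) := by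
      simp only [Finset.mem_filter, Finset.mem_union, Finsupp.mem_support_iff]
      omega
    exact absurd hs (not_lt.2 (Finset.le_max' _ s hs'))
  rcases lt_or_gt_of_ne h1.2 with h3 | h3
  · exact Or.inr (Or.inr ⟨r, h3, fun s hs => (h2 s hs).symm⟩)
  · exact Or.inl ⟨r, h3, h2⟩

theorem principalGT_irrefl (x : Index) : ¬ PrincipalGT x x := by
  simp [PrincipalGT, lexGT_irrefl]

theorem principalGT_trans {x y z : Index} (h : PrincipalGT x y) (h' : PrincipalGT y z) :
    PrincipalGT x z := by
  unfold PrincipalGT at *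
  rcases h with h | ⟨h, l⟩ | ⟨h, l⟩ | ⟨h, h1, l⟩ | ⟨h, h1, l⟩ <;>
  rcases h' with h' | ⟨h', l'⟩ | ⟨h', l'⟩ | ⟨h', h1', l'⟩ | ⟨h', h1', l'⟩ <;>
  first
    | (left; exact h'.trans h)
    | (left; exact h ▸ h')
    | (left; exact h' ▸ h)
    | (right; left; exact ⟨h.trans h', lexGT_trans l' l⟩)
    | (right; left; rw [h]; exact ⟨h', l'⟩)
    | (right; left; rw [← h']; exact ⟨h, l⟩)
    | (right; right; left; exact ⟨h.trans h', l'.trans l⟩)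
    | (right; right; left; refine ⟨h.trans h', ?_⟩; rw [h1]; exact l')
    | (right; right; left; refine ⟨h.trans h', ?_⟩; rw [← h1']; exact l)
    | (right; right; right; left; exact ⟨h.trans h', h1.trans h1', lexGT_trans l l'⟩)
    | (right; right; right; left; refine ⟨h.trans h', ?_⟩; rw [h1]; exact ⟨h1', l'⟩)
    | (right; right; right; left; refine ⟨h.trans h', ?_⟩; rw [← h1']; exact ⟨h1, l⟩)
    | (right; right; right; right; exact ⟨h.trans h', h1.trans h1', lexGT_trans l l'⟩)

theorem principalGT_total (x y : Index) : PrincipalGT x y ∨ x = y ∨ PrincipalGT y x := by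
  rcases lt_trichotomy (size x.j) (size y.j) with h | h | h
  · exact Or.inr (Or.inr (Or.inl h))
  · rcases lexGT_total x.j y.j with h1 | h1 | h1
    · exact Or.inr (Or.inr (Or.inr (Or.inl ⟨h.symm, h1⟩)))
    · rcases lt_trichotomy (sizeQ x.k) (sizeQ y.k) with h' | h' | h'
      · exact Or.inr (Or.inr (Or.inr (Or.inr (Or.inl ⟨h1.symm, h'⟩))))
      · rcases lexGT_total x.k y.k with h2 | h2 | h2
        · exact Or.inl (Or.inr (Or.inr (Or.inr (Or.inl ⟨h1, h', h2⟩))))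
        · rcases lexGT_total x.i y.i with h3 | h3 | h3
          · exact Or.inl (Or.inr (Or.inr (Or.inr (Or.inr ⟨h1, h2, h3⟩))))
          · exact Or.inr (Or.inl (Index.ext h3 h1 h2))
          · exact Or.inr (Or.inr (Or.inr (Or.inr (Or.inr (Or.inr ⟨h1.symm, h2.symm, h3⟩)))))
        · exact Or.inr (Or.inr (Or.inr (Or.inr (Or.inr (Or.inl ⟨h1.symm, h'.symm, h2⟩)))))
      · exact Or.inl (Or.inr (Or.inr (Or.inl ⟨h1, h'⟩)))
    · exact Or.inl (Or.inr (Or.inl ⟨h, h1⟩))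
  · exact Or.inl (Or.inl h)

open Classical in
/-- The principal total order. -/
instance : LinearOrder Index :=
  haveI : IsStrictTotalOrder Index (fun x y => PrincipalGT y x) :=
    { irrefl := principalGT_irrefl
      trans := fun _ _ _ h h' => principalGT_trans h' h
      trichotomous := fun x y h h' => by
        rcases principalGT_total x y with h1 | h1 | h1
        · exact absurd h1 h'
        · exact h1
        · exact absurd h1 h }
  linearOrderOfSTO (fun x y => PrincipalGT y x)

theorem gt_iff (x y : Index) : x > y ↔ PrincipalGT x y := Iff.rfl

theorem le_size (i : Expo) (n : ℕ+) (hn : i n ≠ 0) : (i n : ℚ) * (n : ℕ) ≤ size i :=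
  Finset.single_le_sum (f := fun n => (i n : ℚ) * (n : ℕ)) (fun _ _ => by positivity)
    (Finsupp.mem_support_iff.2 hn)

theorem finite_size (q : ℚ) : {i : Expo | size i ≤ q}.Finite := by
  refine Set.Finite.subset
    (Finset.finite_toSet ((Finset.Icc 1 (Nat.succPNat ⌈q⌉₊) : Finset ℕ+).finsupp
      (fun _ => Finset.range (⌈q⌉₊ + 1)))) ?_
  intro i hi
  have hi' : size i ≤ q := hi
  have hq : q ≤ ⌈q⌉₊ := Nat.le_ceil q
  have key : ∀ n, i n ≠ 0 → i n * (n : ℕ) ≤ ⌈q⌉₊ := fun n hn => by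
    have := (le_size i n hn).trans (hi'.trans hq)
    exact_mod_cast this
  rw [Finset.mem_coe, Finset.mem_finsupp_iff]
  refine ⟨fun n hn => ?_, fun n _ => ?_⟩
  · have hn := Finsupp.mem_support_iff.1 hn
    have h1 := key n hn
    have h2 : (n : ℕ) ≤ i n * n := Nat.le_mul_of_pos_left _ (Nat.pos_of_ne_zero hn)
    rw [Finset.mem_Icc]
    refine ⟨one_le, ?_⟩
    rw [← PNat.coe_le_coe, Nat.succPNat_coe]
    omega
  · rw [Finset.mem_range]
    by_cases hn : i n = 0
    · omega
    · have h1 := key n hn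
      have h2 : i n ≤ i n * n := Nat.le_mul_of_pos_right _ n.pos
      omega

theorem size_nonneg (i : Expo) : 0 ≤ size i := Finset.sum_nonneg fun _ _ => by positivity

theorem size_le_sizeQ (k : Expo) : size k ≤ 2 * sizeQ k := by
  unfold size sizeQ Finsupp.sum
  rw [Finset.mul_sum]
  refine Finset.sum_le_sum fun n _ => ?_
  have h1 : (1 : ℚ) ≤ (n : ℕ) := by exact_mod_cast n.pos
  have h2 : (0 : ℚ) ≤ k n := by positivity
  nlinarith

theorem finite_length (q : ℚ) : {x : Index | x.length = q}.Finite := by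
  have h := ((finite_size q).prod ((finite_size q).prod (finite_size (2 * q))))
  refine Set.Finite.of_finite_image (f := fun x : Index => (x.i, x.j, x.k))
    (h.subset ?_) ?_
  · rintro _ ⟨x, hx, rfl⟩
    have hx' : size x.i + size x.j + sizeQ x.k = q := hx
    have h1 := size_nonneg x.i
    have h2 := size_nonneg x.j
    have h3 := size_nonneg x.k
    have h4 := size_le_sizeQ x.k
    simp only [Set.mem_prod, Set.mem_ofPred_eq]
    refine ⟨?_, ?_, ?_⟩ <;> linarith
  · rintro x - y - h
    simp only [Prod.mk.injEq] at h
    exact Index.ext h.1 h.2.1 h.2.2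

/-- The labels of length `q`, that is, the labels of the vectors in `S_q`. -/
def labels (q : ℚ) : Finset Index := (finite_length q).toFinset

/-- `p(q)`, the number of labels of length `q`. -/
def p (q : ℚ) : ℕ := (labels q).card

/-- The labels of length `q` listed in decreasing order. -/
def label (q : ℚ) (a : Fin (p q)) : Index := (labels q).orderEmbOfFin rfl a.rev

/-! ### The ordered bases and the matrix of the form -/

/-- The ordered product `⋯ (f 2)^{i_2} (f 1)^{i_1}`. -/
def monomial (f : ℕ+ → U) (i : Expo) : U :=
  ((i.support.sort (fun a b => b ≤ a)).map fun n => f n ^ i n).prod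

/-- `L^i = ⋯ L_{-2}^{i_2} L_{-1}^{i_1}`. -/
def Lpow (i : Expo) : U := monomial (fun n => g (.L (-(n : ℤ)))) i

/-- `M^j = ⋯ M_{-2}^{j_2} M_{-1}^{j_1}`. -/
def Mpow (j : Expo) : U := monomial (fun n => g (.M (-(n : ℤ)))) j

/-- `Q^k = ⋯ Q_{-2+1/2}^{k_2} Q_{-1+1/2}^{k_1}`. -/
def Qpow (k : Expo) : U := monomial (fun n => g (.Q (-(n : ℤ)))) k

/-- The vector `Q^k M^j L^i 𝟏` of the Verma module. -/
def vec (lam : Fin 4 → ℂ) (x : Index) : Verma lam :=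
  (Qpow x.k * Mpow x.j * Lpow x.i) • vacuum lam

/-- The label of `u* = Q^k M^i L^j 𝟏` for `u = Q^k M^j L^i 𝟏`. -/
def Index.star (x : Index) : Index := ⟨x.j, x.i, x.k, x.k_le_one⟩

/-- The matrix `D_q` with entries `⟨b_a, b_b*⟩`, where `b_1 > b_2 > ⋯` are the elements of `S_q`. -/
def D (lam : Fin 4 → ℂ) (q : ℚ) : Matrix (Fin (p q)) (Fin (p q)) ℂ :=
  fun a b => form lam (vec lam (label q a)) (vec lam (label q b).star)

/-- The value `∏_r i_r! (r (2h₂ + (r²-1)/12 c₂))^{i_r} · ∏_t (2h₂ + (4(t-1/2)²-1)/12 c₂)^{k_t} ·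
∏_s j_s! (s (2h₂ + (s²-1)/12 c₂))^{j_s}` attached to the label `(i, j, k)`; here `t` labels the
mode `t - 1/2`. -/
def diagEntry (h₂ c₂ : ℂ) (x : Index) : ℂ :=
  (∏ r ∈ x.i.support,
    ((x.i r).factorial : ℂ) * ((r : ℕ) * (2 * h₂ + (((r : ℕ) : ℂ) ^ 2 - 1) / 12 * c₂)) ^ x.i r) *
  (∏ t ∈ x.k.support,
    (2 * h₂ + (4 * (((t : ℕ) : ℂ) - 1 / 2) ^ 2 - 1) / 12 * c₂) ^ x.k t) *
  ∏ s ∈ x.j.support,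
    ((x.j s).factorial : ℂ) * ((s : ℕ) * (2 * h₂ + (((s : ℕ) : ℂ) ^ 2 - 1) / 12 * c₂)) ^ x.j s

end BMS

end

noncomputable section

namespace BMS

/-! ### Super Jacobi identity -/

/-! Since the `M` commute with each other and with the `Q`, the product behind the pairing of the
vector labelled `(i, j, k)` with the starred vector of `(i', j', k')` can be regrouped into three
blocks: `L̄^i M^{i'}`, then `Q̄^k Q^{k'}`, then `M̄^j L^{j'}` (`form_vec_star`). A block that maps
the highest weight vector to a multiple of itself can be replaced by that scalar, starting from the
right (`vac_mul_of_smul_vacuum`). The principal order tests the blocks in the same sequence. A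
strict inequality at `j` makes the rightmost block kill the vacuum. If `j = j'`, that block is a
scalar and `k` decides in the same way. If also `k = k'`, the lengths of `i` and `i'` agree, and
invariance of the vacuum functional under the anti-involution turns the last block into `M̄^{i'}
L^i`, so that `i` decides. On the diagonal all three blocks are scalars.

Each block reduces to a pairing of raising with lowering modes. Surplus positive degree kills the
vacuum. Otherwise the largest mode is removed first. If `t` is at least every index in `S`, then
commuting `L_{-t}` through `M_S` leaves only the contractions with `M_t`, each worth `t (2h₂ + (t² -
1)/12 c₂)`; the other commutators vanish by degree (`raiseM_smul_L_smul`). Repeated letters give the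
factorials, and a largest letter missing from the raising side gives zero. The `Q` behave alike,
with exponents at most one (`Q_smul_lowerQ_smul_vacuum`, `Q_smul_Q_smul_lowerQ_smul_vacuum`).

It remains to see that the Harish-Chandra projection exists, so that the form is not built on the
placeholder `0`. For this the full PBW theorem is not needed. Over the polynomial ring `U₀`, let the
superalgebra act on words in `𝔤₋` by the universal weight, and divide by the defects of the
relations of `𝔤₋`. The Jacobi identity makes the defects stable under the action
(`op_mem_defects_of_isDefect`), and the coefficient of the empty word vanishes on them
(`defects_le_ker`). The matrix coefficient of the highest weight vector in the quotient is the
projection. -/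

/-- The bracket with a basis vector on the left. -/
def adLeft (x : Gen) : Alg →ₗ[ℂ] Alg := Finsupp.linearCombination ℂ (bracket x)

/-- The bracket with a basis vector on the right. -/
def adRight (y : Gen) : Alg →ₗ[ℂ] Alg := Finsupp.linearCombination ℂ (fun x => bracket x y)

@[simp] theorem adLeft_e (x y : Gen) : adLeft x (e y) = bracket x y := by
  simp [adLeft, e]

@[simp] theorem adRight_e (x y : Gen) : adRight y (e x) = bracket x y := by
  simp [adRight, e]

theorem koszul_comm (x y : Gen) : koszul x y = koszul y x := by
  cases x <;> cases y <;> rfl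

theorem koszul_mul_self (x y : Gen) : koszul x y * koszul x y = 1 := by
  cases x <;> cases y <;> simp [koszul]

theorem bracket_swap (x y : Gen) : bracket x y = -(koszul x y • bracket y x) := by
  cases x <;> cases y <;> simp only [bracket, koszul, one_smul, neg_neg, neg_smul, smul_zero,
    neg_zero]
  case L.L m n =>
    unfold brLL
    rw [add_comm n m]
    by_cases h : m + n = 0
    · obtain rfl : n = -m := by omega
      simp; module
    · simp only [h, if_false]; module
  case Q.Q k l =>
    unfold brQQ
    rw [add_comm l k]
    by_cases h : k + l + 1 = 0
    · obtain rfl : l = -k - 1 := by omega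
      rw [if_pos h, if_pos h]; push_cast; module
    · simp only [h, if_false]

/-- In this form `z` acts as a superderivation of the bracket, which is what `mul_relator` uses to
carry a letter across a relator. -/
theorem jacobi (x y z : Gen) :
    adLeft z (bracket x y) = adRight y (bracket z x) + koszul z x • adLeft x (bracket z y) := by
  cases x <;> cases y <;> cases z <;>
    simp only [bracket, koszul, brLL, brLM, brLQ, brQQ, map_add, map_smul, map_neg, map_zero,
      adLeft_e, adRight_e, smul_zero, smul_neg, neg_zero, add_zero, one_smul, neg_smul]
  case L.L.L m n p =>
    push_cast
    -- Once the sums are in normal form, all central terms carry the same condition. The identity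
    -- between their coefficients holds only when the modes sum to zero, so one mode is eliminated
    -- in that case.
    simp only [Int.add_comm, Int.add_left_comm]
    split_ifs with h
    · have hc : ((p : ℤ) : ℂ) = -m - n := by
        have := congrArg (Int.cast : ℤ → ℂ) h
        push_cast at this
        linear_combination this
      simp only [hc]
      module
    · module
  case L.L.M m n p =>
    push_cast
    simp only [Int.add_comm, Int.add_left_comm]
    split_ifs with h
    · have hc : ((p : ℤ) : ℂ) = -m - n := by
        have := congrArg (Int.cast : ℤ → ℂ) h
        push_cast at this
        linear_combination this
      simp only [hc]
      module
    · module
  case L.M.L m n p =>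
    push_cast
    simp only [Int.add_comm, Int.add_left_comm]
    split_ifs with h
    · have hc : ((p : ℤ) : ℂ) = -m - n := by
        have := congrArg (Int.cast : ℤ → ℂ) h
        push_cast at this
        linear_combination this
      simp only [hc]
      module
    · module
  case M.L.L m n p =>
    push_cast
    simp only [Int.add_comm, Int.add_left_comm]
    split_ifs with h
    · have hc : ((p : ℤ) : ℂ) = -m - n := by
        have := congrArg (Int.cast : ℤ → ℂ) h
        push_cast at this
        linear_combination this
      simp only [hc]
      module
    · module
  case L.Q.Q n k l =>
    push_cast
    simp only [Int.add_assoc, Int.add_comm, Int.add_left_comm]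
    split_ifs with h
    · have hc : ((n : ℤ) : ℂ) = -k - l - 1 := by
        have := congrArg (Int.cast : ℤ → ℂ) h
        push_cast at this
        linear_combination this
      simp only [hc]
      module
    · module
  case Q.L.Q k n l =>
    push_cast
    simp only [Int.add_assoc, Int.add_comm, Int.add_left_comm]
    split_ifs with h
    · have hc : ((n : ℤ) : ℂ) = -k - l - 1 := by
        have := congrArg (Int.cast : ℤ → ℂ) h
        push_cast at this
        linear_combination this
      simp only [hc]
      module
    · module
  case Q.Q.L k l n =>
    push_cast
    simp only [Int.add_assoc, Int.add_comm, Int.add_left_comm]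
    split_ifs with h
    · have hc : ((n : ℤ) : ℂ) = -k - l - 1 := by
        have := congrArg (Int.cast : ℤ → ℂ) h
        push_cast at this
        linear_combination this
      simp only [hc]
      module
    · module
  case L.L.Q =>
    push_cast
    simp only [Int.add_comm, Int.add_left_comm]
    module
  case L.Q.L =>
    push_cast
    simp only [Int.add_comm, Int.add_left_comm]
    module
  case Q.L.L =>
    push_cast
    simp only [Int.add_comm, Int.add_left_comm]
    module

/-! ### Support of brackets -/

/-- The span of the basis vectors with a given property. -/
abbrev spanOf (S : Gen → Prop) : Submodule ℂ Alg := Finsupp.supported ℂ ℂ {z | S z}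

theorem e_mem_spanOf {S : Gen → Prop} {x : Gen} (h : S x) : e x ∈ spanOf S :=
  Finsupp.single_mem_supported ℂ 1 h

theorem map_mem_of_mem_spanOf {S : Gen → Prop} {V : Type*} [AddCommGroup V] [Module ℂ V]
    (f : Alg →ₗ[ℂ] V) (W : Submodule ℂ V) (h : ∀ z, S z → f (e z) ∈ W) {a : Alg}
    (ha : a ∈ spanOf S) : f a ∈ W := by
  have h1 : spanOf S ≤ W.comap f := by
    rw [spanOf, Finsupp.supported_eq_span_single, Submodule.span_le]
    rintro _ ⟨z, hz, rfl⟩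
    exact h z hz
  exact h1 ha

theorem smul_e_mem_spanOf {S : Gen → Prop} {x : Gen} (c : ℂ) (h : S x) : c • e x ∈ spanOf S :=
  Submodule.smul_mem _ _ (e_mem_spanOf h)

theorem ite_smul_e_mem_spanOf {S : Gen → Prop} {x : Gen} {q : Prop} [Decidable q] (c : ℂ)
    (h : q → S x) : (if q then c else 0) • e x ∈ spanOf S := by
  split_ifs with hq
  · exact smul_e_mem_spanOf c (h hq)
  · simp

/-- A bracket lies in the span of a set of basis vectors if it does so for each of its terms. -/
theorem bracket_mem_spanOf {S : Gen → Prop} (x y : Gen)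
    (hLL : ∀ m n, x = .L m → y = .L n → S (.L (m + n)) ∧ (m + n = 0 → S .c₁))
    (hLM : ∀ m n, x = .L m ∧ y = .M n ∨ x = .M n ∧ y = .L m →
      S (.M (m + n)) ∧ (m + n = 0 → S .c₂))
    (hLQ : ∀ m k, x = .L m ∧ y = .Q k ∨ x = .Q k ∧ y = .L m → S (.Q (m + k)))
    (hQQ : ∀ k l, x = .Q k → y = .Q l → S (.M (k + l + 1)) ∧ (k + l + 1 = 0 → S .c₂)) :
    bracket x y ∈ spanOf S := by
  have hM : ∀ m n, x = .L m ∧ y = .M n ∨ x = .M n ∧ y = .L m → brLM m n ∈ spanOf S :=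
    fun m n h => add_mem (smul_e_mem_spanOf _ (hLM m n h).1) (ite_smul_e_mem_spanOf _ (hLM m n h).2)
  have hQ : ∀ m k, x = .L m ∧ y = .Q k ∨ x = .Q k ∧ y = .L m → brLQ m k ∈ spanOf S :=
    fun m k h => smul_e_mem_spanOf _ (hLQ m k h)
  cases x <;> cases y
  case L.L m n =>
    exact add_mem (smul_e_mem_spanOf _ (hLL m n rfl rfl).1)
      (ite_smul_e_mem_spanOf _ (hLL m n rfl rfl).2)
  case Q.Q k l =>
    exact add_mem (smul_e_mem_spanOf _ (hQQ k l rfl rfl).1)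
      (ite_smul_e_mem_spanOf _ (hQQ k l rfl rfl).2)
  case L.M m n => exact hM m n (Or.inl ⟨rfl, rfl⟩)
  case M.L n m => exact neg_mem (hM m n (Or.inr ⟨rfl, rfl⟩))
  case L.Q m k => exact hQ m k (Or.inl ⟨rfl, rfl⟩)
  case Q.L k m => exact neg_mem (hQ m k (Or.inr ⟨rfl, rfl⟩))
  all_goals exact zero_mem _

/-- Parity is additive, so every term of `[y, z]` has the same sign against `x`. This allows the
linear maps `relatorLeft` and `relatorRight` to carry one fixed sign. -/
theorem bracket_mem_spanOf_koszul (x y z : Gen) :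
    bracket y z ∈ spanOf (fun w => koszul x w = koszul x y * koszul x z) := by
  refine bracket_mem_spanOf y z ?_ ?_ ?_ ?_
  · rintro m n rfl rfl
    cases x <;> simp [koszul]
  · rintro m n (⟨rfl, rfl⟩ | ⟨rfl, rfl⟩) <;> cases x <;> simp [koszul]
  · rintro m n (⟨rfl, rfl⟩ | ⟨rfl, rfl⟩) <;> cases x <;> simp [koszul]
  · rintro m n rfl rfl
    cases x <;> simp [koszul]

theorem bracket_mem_spanOf_neg {x y : Gen} (hx : IsNeg x) (hy : IsNeg y) :
    bracket x y ∈ spanOf IsNeg := by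
  refine bracket_mem_spanOf x y ?_ ?_ ?_ ?_
  · rintro m n rfl rfl
    simp only [IsNeg] at *; omega
  · rintro m n (⟨rfl, rfl⟩ | ⟨rfl, rfl⟩) <;> simp only [IsNeg] at * <;> omega
  · rintro m n (⟨rfl, rfl⟩ | ⟨rfl, rfl⟩) <;> simp only [IsNeg] at * <;> omega
  · rintro m n rfl rfl
    simp only [IsNeg] at *; omega

theorem bracket_mem_spanOf_not_neg {x y : Gen} (hx : ¬ IsNeg x) (hy : ¬ IsNeg y) :
    bracket x y ∈ spanOf (fun z => ¬ IsNeg z) := by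
  refine bracket_mem_spanOf x y ?_ ?_ ?_ ?_
  · rintro m n rfl rfl
    exact ⟨by simp only [IsNeg] at *; omega, fun _ => id⟩
  · rintro m n (⟨rfl, rfl⟩ | ⟨rfl, rfl⟩) <;>
      exact ⟨by simp only [IsNeg] at *; omega, fun _ => id⟩
  · rintro m n (⟨rfl, rfl⟩ | ⟨rfl, rfl⟩) <;> simp only [IsNeg] at * <;> omega
  · rintro m n rfl rfl
    exact ⟨by simp only [IsNeg] at *; omega, fun _ => id⟩

/-! ### Relators -/

section Relator

variable {E : Type*} [Ring E] [Algebra ℂ E] (f : Gen → E)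

/-- The linear extension of a map on the basis of the superalgebra. -/
abbrev lin : Alg →ₗ[ℂ] E := Finsupp.linearCombination ℂ f

@[simp] theorem lin_e (x : Gen) : lin f (e x) = f x := by simp [e]

/-- The defect of the relation for `x` and `y` under the map `f`. -/
def relator (x y : Gen) : E := f x * f y - koszul x y • (f y * f x) - lin f (bracket x y)

theorem relator_swap (x y : Gen) : relator f x y = -(koszul x y • relator f y x) := by
  rw [relator, relator, bracket_swap x y, koszul_comm y x]
  simp only [map_neg, map_smul, smul_sub, smul_smul, koszul_mul_self]
  module

/-- The defect of the relation for a basis vector `x` and a vector whose sign is `s`. -/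
def relatorLeft (s : ℂ) (x : Gen) : Alg →ₗ[ℂ] E :=
  LinearMap.mulLeft ℂ (f x) ∘ₗ lin f - s • (LinearMap.mulRight ℂ (f x) ∘ₗ lin f) -
    lin f ∘ₗ adLeft x

/-- The defect of the relation for a vector whose sign is `s` and a basis vector `y`. -/
def relatorRight (s : ℂ) (y : Gen) : Alg →ₗ[ℂ] E :=
  LinearMap.mulRight ℂ (f y) ∘ₗ lin f - s • (LinearMap.mulLeft ℂ (f y) ∘ₗ lin f) -
    lin f ∘ₗ adRight y

theorem relatorLeft_e (x y : Gen) : relatorLeft f (koszul x y) x (e y) = relator f x y := by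
  simp [relatorLeft, relator]

theorem relatorRight_e (x y : Gen) : relatorRight f (koszul x y) y (e x) = relator f x y := by
  simp [relatorRight, relator]

/-- The supercommutator of `f z` with a relator is again a combination of relators: moving `f z`
through the quadratic terms produces relators of `z` with `x` and `y`, and the linear terms that
remain cancel by the Jacobi identity. It holds for any map `f` and drives both inductions below. -/
theorem mul_relator (x y z : Gen) :
    f z * relator f x y = (koszul z x * koszul z y) • (relator f x y * f z) +
      relator f z x * f y + koszul z x • (f x * relator f z y) -
      koszul x y • (relator f z y * f x + koszul z y • (f y * relator f z x)) -
      relatorLeft f (koszul z x * koszul z y) z (bracket x y) +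
      relatorRight f (koszul x y * koszul z y) y (bracket z x) +
      koszul z x • relatorLeft f (koszul z x * koszul x y) x (bracket z y) := by
  have h := congrArg (lin f) (jacobi x y z)
  rw [map_add, map_smul] at h
  simp only [relator, relatorLeft, relatorRight, LinearMap.sub_apply, LinearMap.smul_apply,
    LinearMap.comp_apply, LinearMap.mulLeft_apply, LinearMap.mulRight_apply, h, mul_sub, sub_mul,
    smul_sub, smul_add, smul_smul, mul_smul_comm, smul_mul_assoc, mul_assoc]
  have h1 : koszul z x * (koszul z x * koszul x y) = koszul x y := by
    rw [← mul_assoc, koszul_mul_self, one_mul]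
  rw [h1]
  module

/-- A subspace that contains the images under a linear map of the relators of `x` with the terms of
a bracket contains the image of the defect for `x` and that bracket. -/
theorem relatorLeft_mem {V : Type*} [AddCommGroup V] [Module ℂ V] (φ : E →ₗ[ℂ] V)
    (W : Submodule ℂ V) {S : Gen → Prop} (x y z : Gen) (ha : bracket y z ∈ spanOf S)
    (h : ∀ w, S w → φ (relator f x w) ∈ W) :
    φ (relatorLeft f (koszul x y * koszul x z) x (bracket y z)) ∈ W := by
  have h2 : bracket y z ∈ spanOf (fun w => koszul x w = koszul x y * koszul x z ∧ S w) :=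
    fun w hw => ⟨bracket_mem_spanOf_koszul x y z hw, ha hw⟩
  refine map_mem_of_mem_spanOf (φ ∘ₗ relatorLeft f _ x) W ?_ h2
  rintro w ⟨hw, hS⟩
  rw [LinearMap.comp_apply, ← hw, relatorLeft_e]
  exact h w hS

theorem relatorRight_mem {V : Type*} [AddCommGroup V] [Module ℂ V] (φ : E →ₗ[ℂ] V)
    (W : Submodule ℂ V) {S : Gen → Prop} (x y z : Gen) (ha : bracket y z ∈ spanOf S)
    (h : ∀ w, S w → φ (relator f w x) ∈ W) :
    φ (relatorRight f (koszul x y * koszul x z) x (bracket y z)) ∈ W := by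
  have h2 : bracket y z ∈ spanOf (fun w => koszul x w = koszul x y * koszul x z ∧ S w) :=
    fun w hw => ⟨bracket_mem_spanOf_koszul x y z hw, ha hw⟩
  refine map_mem_of_mem_spanOf (φ ∘ₗ relatorRight f _ x) W ?_ h2
  rintro w ⟨hw, hS⟩
  rw [LinearMap.comp_apply, ← hw, koszul_comm, relatorRight_e]
  exact h w hS

end Relator

/-! ### The universal highest weight action -/

/-- The basis of `𝔤₋` as a type. -/
abbrev NegGen : Type := {x : Gen // IsNeg x}

section

variable {K : Type} [CommRing K] (χ : Fin 4 → K)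

/-- The weight that maps `L₀, M₀, c₁, c₂` to the values of `χ` and all else to `0`. -/
def hwt : Gen → K
  | .L n => if n = 0 then χ 0 else 0
  | .M n => if n = 0 then χ 1 else 0
  | .Q _ => 0
  | .c₁ => χ 2
  | .c₂ => χ 3

theorem hwt_cartan (i : Fin 4) : hwt χ (cartan i) = χ i := by
  fin_cases i <;> rfl

theorem hwt_of_isPos {x : Gen} (hx : IsPos x) : hwt χ x = 0 := by
  cases x <;> simp [hwt, IsPos] at * <;> omega

end

section HighestWeight

variable (K : Type) [CommRing K] [Algebra ℂ K]

/-- The free `K`-module on the words in the basis of `𝔤₋`. -/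
def WordSpace : Type := List NegGen →₀ K

instance : AddCommGroup (WordSpace K) := inferInstanceAs (AddCommGroup (List NegGen →₀ K))

instance : Module K (WordSpace K) := inferInstanceAs (Module K (List NegGen →₀ K))

instance : Module ℂ (WordSpace K) := inferInstanceAs (Module ℂ (List NegGen →₀ K))

instance : IsScalarTower ℂ K (WordSpace K) :=
  inferInstanceAs (IsScalarTower ℂ K (List NegGen →₀ K))

/-- The words as a basis. -/
def word : Module.Basis (List NegGen) K (WordSpace K) := Finsupp.basisSingleOne

variable {K} (χ : Fin 4 → K)

/-- Prepend a letter to all words. -/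
def consMap (y : NegGen) : Module.End K (WordSpace K) :=
  (word K).constr ℂ fun w => word K (y :: w)

@[simp] theorem consMap_word (y : NegGen) (w : List NegGen) :
    consMap y (word K w) = word K (y :: w) := (word K).constr_basis ℂ _ w

open Classical in
/-- The action of a basis vector on a word: letters of `𝔤₋` are prepended, the others are moved to
the right by the commutation relations until they act on the empty word by the weight. -/
def actWord : List NegGen → Gen → WordSpace K
  | [], x => if h : IsNeg x then word K [⟨x, h⟩] else hwt χ x • word K []
  | y :: w, x =>
    if h : IsNeg x then word K (⟨x, h⟩ :: y :: w)
    else koszul x y • consMap y (actWord w x) +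
      Finsupp.linearCombination ℂ (actWord w) (bracket x y)

/-- The action of a basis vector on the word space. -/
def op (x : Gen) : Module.End K (WordSpace K) :=
  (word K).constr ℂ fun w => actWord χ w x

@[simp] theorem op_word (x : Gen) (w : List NegGen) : op χ x (word K w) = actWord χ w x :=
  (word K).constr_basis ℂ _ w

/-- Evaluation at a vector, as a map that is linear over the complex numbers. -/
def evalAt (t : WordSpace K) : Module.End K (WordSpace K) →ₗ[ℂ] WordSpace K where
  toFun f := f t
  map_add' _ _ := rfl
  map_smul' _ _ := rfl

@[simp] theorem evalAt_apply (t : WordSpace K) (f : Module.End K (WordSpace K)) :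
    evalAt t f = f t := rfl

theorem lin_op_word (a : Alg) (w : List NegGen) :
    lin (op χ) a (word K w) = Finsupp.linearCombination ℂ (actWord χ w) a := by
  have h : evalAt (word K w) ∘ₗ lin (op χ) = Finsupp.linearCombination ℂ (actWord χ w) := by
    ext x
    simp
  exact LinearMap.congr_fun h a

theorem op_neg (x : NegGen) : op χ x = consMap x := by
  refine (word K).ext fun w => ?_
  obtain ⟨x, hx⟩ := x
  cases w <;> simp [actWord, hx]

/-- This is the recursive clause of `actWord`: the mixed relations hold by construction. -/
theorem op_mul_op {x : Gen} (hx : ¬ IsNeg x) (y : NegGen) :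
    op χ x * op χ y = koszul x y • (op χ y * op χ x) + lin (op χ) (bracket x y) := by
  refine (word K).ext fun w => ?_
  simp [op_neg, lin_op_word, actWord, hx]

theorem relator_of_neg_right {x y : Gen} (hx : ¬ IsNeg x) (hy : IsNeg y) :
    relator (op χ) x y = 0 := by
  rw [relator, op_mul_op χ hx ⟨y, hy⟩]
  simp

theorem relator_of_neg_left {x y : Gen} (hx : IsNeg x) (hy : ¬ IsNeg y) :
    relator (op χ) x y = 0 := by
  rw [relator_swap, relator_of_neg_right χ hy hx, smul_zero, neg_zero]

/-- The weight is a character of `𝔤₀ ⊕ 𝔤₊`. Two modes that are not negative sum to zero only if both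
are zero, and then the structure constants vanish; two such `Q` never reach mode zero. -/
theorem linearCombination_hwt_bracket {x y : Gen} (hx : ¬ IsNeg x) (hy : ¬ IsNeg y) :
    Finsupp.linearCombination ℂ (hwt χ) (bracket x y) = 0 := by
  have h := lin_e (E := K) (hwt χ)
  have key : ∀ x y : ℤ, ¬ x < 0 → ¬ y < 0 → x + y = 0 → x = 0 ∧ y = 0 := by omega
  cases x <;> cases y <;> simp only [bracket, brLL, brLM, brLQ, brQQ, IsNeg] at * <;>
    simp only [map_add, map_smul, map_neg, map_zero, h, hwt, smul_zero, neg_zero]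
  case Q.Q k l => rw [if_neg (by omega), if_neg (by omega)]; simp
  all_goals
    split_ifs with h0
    · obtain ⟨rfl, rfl⟩ := key _ _ (by assumption) (by assumption) h0
      simp
    · simp

theorem koszul_ne_zero (x y : Gen) : koszul x y ≠ 0 := fun h => by
  simpa [h] using koszul_mul_self x y

theorem mem_spanOf_true (a : Alg) : a ∈ spanOf (fun _ => True) := fun _ _ => trivial

/-- The action of `𝔤₀ ⊕ 𝔤₊` on the empty word. -/
theorem linearCombination_actWord_nil {a : Alg} (ha : a ∈ spanOf (fun z => ¬ IsNeg z)) :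
    Finsupp.linearCombination ℂ (actWord χ []) a =
      Finsupp.linearCombination ℂ (hwt χ) a • word K [] := by
  rw [← sub_eq_zero]
  refine map_mem_of_mem_spanOf (Finsupp.linearCombination ℂ (actWord χ []) -
    ((LinearMap.toSpanSingleton K _ (word K [])).restrictScalars ℂ) ∘ₗ
      Finsupp.linearCombination ℂ (hwt χ)) ⊥ (fun z hz => ?_) ha
  simp [e, actWord, hz]

/-- The relations for the letters of `𝔤₀ ⊕ 𝔤₊` hold on the word space. -/
theorem relator_of_not_neg_word (w : List NegGen) {x y : Gen} (hx : ¬ IsNeg x) (hy : ¬ IsNeg y) :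
    relator (op χ) x y (word K w) = 0 := by
  -- Brackets of `x` or `y` with a letter of the word bring in other letters, so the hypothesis must
  -- cover all pairs.
  induction w generalizing x y with
  | nil =>
    have h : koszul x y • (hwt χ x * hwt χ y) = hwt χ x * hwt χ y := by
      cases x <;> cases y <;> simp [koszul, hwt]
    simp only [relator, LinearMap.sub_apply, LinearMap.smul_apply, Module.End.mul_apply, op_word,
      lin_op_word, linearCombination_actWord_nil χ (bracket_mem_spanOf_not_neg hx hy),
      linearCombination_hwt_bracket χ hx hy, zero_smul, sub_zero]
    simp only [actWord, hx, hy, dif_neg, not_false_eq_true, map_smul, smul_smul, op_word]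
    rw [← smul_assoc, h, mul_comm, sub_self]
  | cons z w ih =>
    -- Every term except the relator of `x`, `y` on `z :: w` is zero at `w`: each other relator has
    -- an entry outside `𝔤₋`, so it is mixed or covered by the induction hypothesis. The surviving
    -- term carries a nonzero sign.
    have h := congrArg (evalAt (word K w)) (mul_relator (op χ) x y z)
    have h1 : ∀ x y, ¬ IsNeg x ∨ ¬ IsNeg y → relator (op χ) x y (word K w) = 0 := by
      intro x y hxy
      by_cases hx : IsNeg x
      · rw [relator_of_neg_left χ hx (hxy.resolve_left (not_not.2 hx))]; rfl
      · by_cases hy : IsNeg y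
        · rw [relator_of_neg_right χ hx hy]; rfl
        · exact ih hx hy
    have h2 := relatorLeft_mem (op χ) (evalAt (word K w)) ⊥ z x y
      (bracket_mem_spanOf_not_neg hx hy) (fun v hv => h1 z v (Or.inr hv))
    have h3 := relatorRight_mem (op χ) (evalAt (word K w)) ⊥ y z x
      (mem_spanOf_true _) (fun v _ => h1 v y (Or.inr hy))
    have h4 := relatorLeft_mem (op χ) (evalAt (word K w)) ⊥ x z y
      (mem_spanOf_true _) (fun v _ => h1 x v (Or.inl hx))
    rw [Submodule.mem_bot] at h2 h3 h4
    rw [koszul_comm y z, koszul_comm y x, mul_comm] at h3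
    rw [koszul_comm x z] at h4
    rw [relator_of_neg_left χ z.2 hx, relator_of_neg_left χ z.2 hy] at h
    simp only [map_add, map_sub, map_smul, h2, h3, h4, evalAt_apply, Module.End.mul_apply,
      ih hx hy, map_zero, zero_mul, mul_zero, smul_zero, add_zero, sub_zero] at h
    rw [op_neg, consMap_word] at h
    have h5 := mul_ne_zero (koszul_ne_zero z x) (koszul_ne_zero z y)
    exact (smul_eq_zero_iff_right h5).1 h.symm

theorem relator_of_not_neg {x y : Gen} (h : ¬ IsNeg x ∨ ¬ IsNeg y) : relator (op χ) x y = 0 := by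
  by_cases hx : IsNeg x
  · exact relator_of_neg_left χ hx (h.resolve_left (not_not.2 hx))
  · by_cases hy : IsNeg y
    · exact relator_of_neg_right χ hx hy
    · exact (word K).ext fun w => by simpa using relator_of_not_neg_word χ w hx hy

/-! ### Defects of the relations of `𝔤₋`: stability and augmentation -/

/-- The defects of the relations of `𝔤₋`, with letters prepended. -/
inductive IsDefect : WordSpace K → Prop
  | relator (x y : NegGen) (t : WordSpace K) : IsDefect (relator (op χ) x y t)
  | cons (z : NegGen) (t : WordSpace K) : IsDefect t → IsDefect (op χ z t)

/-- The submodule of the word space by which `U(𝔤₋)` is the quotient. -/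
def defects : Submodule K (WordSpace K) := Submodule.span K {t | IsDefect χ t}

theorem relator_mem_defects (x y : Gen) (t : WordSpace K) : relator (op χ) x y t ∈ defects χ := by
  by_cases h : ¬ IsNeg x ∨ ¬ IsNeg y
  · rw [relator_of_not_neg χ h]
    exact zero_mem _
  · push Not at h
    exact Submodule.subset_span (.relator ⟨x, h.1⟩ ⟨y, h.2⟩ t)

theorem op_neg_mem_defects (z : NegGen) {t : WordSpace K} (ht : t ∈ defects χ) :
    op χ z t ∈ defects χ := by
  have h : defects χ ≤ (defects χ).comap (op χ z) :=
    Submodule.span_le.2 fun t ht => Submodule.subset_span (.cons z t ht)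
  exact h ht

/-- Letters of `𝔤₋` only prepend. For any other `z`, `mul_relator` turns `z` applied to a relator
into relators at other vectors, which are defects because `IsDefect.relator` allows an arbitrary
vector. A prepended letter is passed by `op_mul_op`, whose bracket term needs the induction
hypothesis for all letters. -/
theorem op_mem_defects_of_isDefect {t : WordSpace K} (ht : IsDefect χ t) (z : Gen) :
    op χ z t ∈ defects χ := by
  induction ht generalizing z with
  | relator x y t =>
    by_cases hz : IsNeg z
    · exact op_neg_mem_defects χ ⟨z, hz⟩ (Submodule.subset_span (.relator x y t))
    have h := congrArg (evalAt t) (mul_relator (op χ) x y z)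
    have h1 := relator_mem_defects χ
    have h2 := relatorLeft_mem (op χ) (evalAt t) ((defects χ).restrictScalars ℂ) z x y
      (mem_spanOf_true _) (fun v _ => h1 z v t)
    have h3 := relatorRight_mem (op χ) (evalAt t) ((defects χ).restrictScalars ℂ) y z x
      (mem_spanOf_true _) (fun v _ => h1 v y t)
    have h4 := relatorLeft_mem (op χ) (evalAt t) ((defects χ).restrictScalars ℂ) x z y
      (mem_spanOf_true _) (fun v _ => h1 x v t)
    rw [koszul_comm y z, koszul_comm y x, mul_comm (koszul z y)] at h3
    rw [koszul_comm x z] at h4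
    rw [relator_of_not_neg χ (Or.inl hz), relator_of_not_neg χ (Or.inl hz)] at h
    simp only [zero_mul, mul_zero, smul_zero, add_zero, sub_zero] at h
    have h5 : ((koszul z x * koszul z y) • (relator (op χ) x y * op χ z)) t ∈
        (defects χ).restrictScalars ℂ := Submodule.smul_mem _ _ (h1 x y _)
    have h6 := Submodule.smul_mem ((defects χ).restrictScalars ℂ) (koszul z x) h4
    have h7 := add_mem (add_mem (sub_mem h5 h2) h3) h6
    change op χ z (relator (op χ) x y t) = _ at h
    rw [h]
    exact h7
  | cons y t ht ih =>
    by_cases hz : IsNeg z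
    · exact op_neg_mem_defects χ ⟨z, hz⟩ (Submodule.subset_span (.cons y t ht))
    have h : op χ z (op χ y t) =
        koszul z y • op χ y (op χ z t) + evalAt t (lin (op χ) (bracket z y)) :=
      congrArg (evalAt t) (op_mul_op χ hz y)
    rw [h]
    have h1 : op χ y (op χ z t) ∈ (defects χ).restrictScalars ℂ := op_neg_mem_defects χ y (ih z)
    have h2 := map_mem_of_mem_spanOf (evalAt t ∘ₗ lin (op χ)) ((defects χ).restrictScalars ℂ)
      (fun v _ => by simpa using ih v) (mem_spanOf_true (bracket z y))
    exact add_mem (Submodule.smul_mem _ _ h1) h2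

theorem defects_le_comap (z : Gen) : defects χ ≤ (defects χ).comap (op χ z) :=
  Submodule.span_le.2 fun _ ht => op_mem_defects_of_isDefect χ ht z

/-- The coefficient of the empty word. -/
def augmentation : WordSpace K →ₗ[K] K := (word K).coord []

theorem augmentation_op (z : NegGen) (t : WordSpace K) : augmentation (op χ z t) = 0 := by
  have h : augmentation ∘ₗ op χ z = 0 := by
    refine (word K).ext fun w => ?_
    simp [op_neg, augmentation]
  exact LinearMap.congr_fun h t

/-- Since `𝔤₋` is closed under the bracket, all three terms of a relator of `𝔤₋` are images of
letters of `𝔤₋` and contain no empty word. Hence the highest weight vector survives in the quotient.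
-/
theorem defects_le_ker : defects χ ≤ LinearMap.ker (augmentation (K := K)) := by
  refine Submodule.span_le.2 fun t ht => ?_
  rw [SetLike.mem_coe, LinearMap.mem_ker]
  cases ht with
  | relator x y t =>
    have h := map_mem_of_mem_spanOf
      ((augmentation (K := K)).restrictScalars ℂ ∘ₗ evalAt t ∘ₗ lin (op χ)) ⊥
      (fun v hv => by simpa using augmentation_op χ ⟨v, hv⟩ t) (bracket_mem_spanOf_neg x.2 y.2)
    have h1 : augmentation (lin (op χ) (bracket x y) t) = 0 := h
    rw [relator, LinearMap.sub_apply, LinearMap.sub_apply, map_sub, map_sub, h1,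
      Module.End.mul_apply, augmentation_op, LinearMap.smul_apply, Module.End.mul_apply,
      ← algebraMap_smul K, map_smul, augmentation_op]
    simp
  | cons z t ht => exact augmentation_op χ z t

/-! ### The universal highest weight module -/

/-- The highest weight module over `K` on the quotient of the word space. -/
abbrev HighestWeight : Type := WordSpace K ⧸ defects χ

/-- The action of a basis vector on the highest weight module. -/
def hwOp (x : Gen) : Module.End K (HighestWeight χ) :=
  (defects χ).mapQ (defects χ) (op χ x) (defects_le_comap χ x)

theorem lin_hwOp_mk (a : Alg) (t : WordSpace K) :
    lin (hwOp χ) a (Submodule.Quotient.mk t) = Submodule.Quotient.mk (lin (op χ) a t) := by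
  induction a using Finsupp.induction_linear with
  | zero => simp
  | add f h hf hh => simp [hf, hh]
  | single z c => simp [hwOp]

theorem hwOp_mul (x y : Gen) :
    hwOp χ x * hwOp χ y = koszul x y • (hwOp χ y * hwOp χ x) + lin (hwOp χ) (bracket x y) := by
  refine LinearMap.ext fun t => ?_
  induction t using Submodule.Quotient.induction_on with
  | H t =>
    have h := (Submodule.Quotient.mk_eq_zero (defects χ)).2 (relator_mem_defects χ x y t)
    rw [relator, LinearMap.sub_apply, LinearMap.sub_apply, sub_sub, Submodule.Quotient.mk_sub,
      sub_eq_zero] at h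
    rw [LinearMap.add_apply, lin_hwOp_mk]
    exact h

/-- The highest weight module as a representation of `U(𝔤)`. -/
def hwRep : U →ₐ[ℂ] Module.End K (HighestWeight χ) :=
  RingQuot.liftAlgHom ℂ ⟨FreeAlgebra.lift ℂ (hwOp χ), by
    rintro _ _ ⟨x, y⟩
    have h : ∀ a, FreeAlgebra.lift ℂ (hwOp χ) (freeIncl a) = lin (hwOp χ) a := by
      intro a
      induction a using Finsupp.induction_linear with
      | zero => simp
      | add f h hf hh => simp [hf, hh]
      | single z c => simp [freeIncl]
    simp [h, hwOp_mul χ x y]⟩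

@[simp] theorem hwRep_g (x : Gen) : hwRep χ (g x) = hwOp χ x := by
  have h : hwRep χ (mk (FreeAlgebra.ι ℂ x)) = FreeAlgebra.lift ℂ (hwOp χ) (FreeAlgebra.ι ℂ x) :=
    RingQuot.liftAlgHom_mkAlgHom_apply ℂ _ _ _
  exact h.trans (FreeAlgebra.lift_ι_apply _ _)

/-- The highest weight vector. -/
def hwVec : HighestWeight χ := Submodule.Quotient.mk (word K [])

theorem hwOp_hwVec {x : Gen} (hx : ¬ IsNeg x) : hwOp χ x (hwVec χ) = hwt χ x • hwVec χ := by
  rw [hwVec, ← Submodule.Quotient.mk_smul]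
  simp [hwOp, actWord, hx]

/-- The coefficient of the highest weight vector. -/
def hwCoeff : HighestWeight χ →ₗ[K] K := (defects χ).liftQ augmentation (defects_le_ker χ)

theorem hwCoeff_hwVec : hwCoeff χ (hwVec χ) = 1 := by
  simp [hwCoeff, hwVec, augmentation]

theorem hwCoeff_hwOp {x : Gen} (hx : IsNeg x) (t : HighestWeight χ) :
    hwCoeff χ (hwOp χ x t) = 0 := by
  induction t using Submodule.Quotient.induction_on with
  | H t => exact augmentation_op χ ⟨x, hx⟩ t

/-! ### Existence of the Harish-Chandra projection -/

/-- The matrix coefficient of the highest weight vector. -/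
def hwFunctional : U →ₗ[ℂ] K :=
  (hwCoeff χ).restrictScalars ℂ ∘ₗ
    { toFun := fun u => hwRep χ u (hwVec χ)
      map_add' := fun u v => by simp
      map_smul' := fun c u => by simp }

theorem hwFunctional_apply (u : U) : hwFunctional χ u = hwCoeff χ (hwRep χ u (hwVec χ)) := rfl

theorem isNeg_cartan (i : Fin 4) : ¬ IsNeg (cartan i) := by
  fin_cases i <;> simp [IsNeg, cartan]

theorem not_isNeg_of_isPos {x : Gen} (hx : IsPos x) : ¬ IsNeg x := by
  cases x <;> simp [IsPos, IsNeg] at * <;> omega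

theorem hwRep_cartan_pow (i : Fin 4) (n : ℕ) :
    hwRep χ (g (cartan i) ^ n) (hwVec χ) = χ i ^ n • hwVec χ := by
  induction n with
  | zero => simp
  | succ n ih =>
    rw [pow_succ', map_mul, Module.End.mul_apply, ih, hwRep_g, map_smul,
      hwOp_hwVec χ (isNeg_cartan i), hwt_cartan, smul_smul, pow_succ]

theorem hwFunctional_cartanMonomial (a : Fin 4 → ℕ) :
    hwFunctional χ (cartanMonomial a) = ∏ i, χ i ^ a i := by
  simp only [hwFunctional_apply, cartanMonomial, map_mul, Module.End.mul_apply,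
    hwRep_cartan_pow, map_smul, hwCoeff_hwVec, Fin.prod_univ_four, smul_eq_mul]
  ring

/-- With the variables of `U₀` as universal weight, `U(𝔤₀)` acts on the highest weight vector by the
corresponding polynomials, `𝔤₊` kills that vector, and images of `𝔤₋` have zero coefficient along
it. -/
theorem isHarishChandra_hwFunctional :
    IsHarishChandra (hwFunctional (MvPolynomial.X : Fin 4 → U₀)) where
  id_on := hwFunctional_cartanMonomial _
  neg_mul x hx u := by
    rw [hwFunctional_apply, map_mul, Module.End.mul_apply, hwRep_g, hwCoeff_hwOp _ hx]
  mul_pos u x hx := by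
    rw [hwFunctional_apply, map_mul, Module.End.mul_apply, hwRep_g,
      hwOp_hwVec _ (not_isNeg_of_isPos hx), hwt_of_isPos _ hx, zero_smul, map_zero, map_zero]

/-- The Harish-Chandra projection exists. -/
theorem isHarishChandra_harishChandra : IsHarishChandra harishChandra := by
  have h : ∃ P, IsHarishChandra P := ⟨_, isHarishChandra_hwFunctional⟩
  rw [harishChandra, dif_pos h]
  exact h.choose_spec

end HighestWeight

/-! ### The grading -/

/-- Twice the degree of a basis vector. -/
def deg : Gen → ℤ
  | .L n => 2 * n
  | .M n => 2 * n
  | .Q k => 2 * k + 1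
  | .c₁ => 0
  | .c₂ => 0

theorem isPos_iff_deg (x : Gen) : IsPos x ↔ 0 < deg x := by
  cases x <;> simp [IsPos, deg]

theorem exists_cartan_of_deg_eq_zero {x : Gen} (hx : deg x = 0) : ∃ i, x = cartan i := by
  refine cartan_of_not x ?_ ?_ <;> cases x <;> simp [IsNeg, IsPos, deg] at * <;> omega

theorem bracket_mem_spanOf_deg (x y : Gen) :
    bracket x y ∈ spanOf (fun z => deg z = deg x + deg y) := by
  refine bracket_mem_spanOf x y ?_ ?_ ?_ ?_
  · rintro m n rfl rfl
    simp only [deg]; omega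
  · rintro m n (⟨rfl, rfl⟩ | ⟨rfl, rfl⟩) <;> simp only [deg] <;> omega
  · rintro m n (⟨rfl, rfl⟩ | ⟨rfl, rfl⟩) <;> simp only [deg] <;> omega
  · rintro m n rfl rfl
    simp only [deg]; omega

/-- The total degree of a word. -/
def wordDeg (l : List Gen) : ℤ := (l.map deg).sum

@[simp] theorem wordDeg_nil : wordDeg [] = 0 := rfl

@[simp] theorem wordDeg_cons (x : Gen) (l : List Gen) : wordDeg (x :: l) = deg x + wordDeg l := rfl

@[simp] theorem wordDeg_append (l l' : List Gen) : wordDeg (l ++ l') = wordDeg l + wordDeg l' := by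
  simp [wordDeg]

theorem wordDeg_nonpos (l : List Gen) (hl : ∀ x ∈ l, ¬ IsPos x) : wordDeg l ≤ 0 := by
  induction l with
  | nil => exact le_rfl
  | cons x l ih =>
    have h1 := hl x List.mem_cons_self
    have h2 := ih fun y hy => hl y (List.mem_cons_of_mem _ hy)
    rw [isPos_iff_deg] at h1
    rw [wordDeg_cons]
    omega

/-- The span of the words of length at most `n` and degree `d`. -/
def gradedFil (n : ℕ) (d : ℤ) : Submodule ℂ U :=
  Submodule.span ℂ {u | ∃ l : List Gen, l.length ≤ n ∧ wordDeg l = d ∧ u = (l.map g).prod}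

theorem gradedFil_mono {m n : ℕ} (h : m ≤ n) (d : ℤ) : gradedFil m d ≤ gradedFil n d :=
  Submodule.span_mono fun _ ⟨l, hl, e⟩ => ⟨l, hl.trans h, e⟩

theorem prod_mem_gradedFil (l : List Gen) : (l.map g).prod ∈ gradedFil l.length (wordDeg l) :=
  Submodule.subset_span ⟨l, le_rfl, rfl, rfl⟩

theorem gradedFil_mul {m n : ℕ} {c d : ℤ} {u v : U} (hu : u ∈ gradedFil m c)
    (hv : v ∈ gradedFil n d) : u * v ∈ gradedFil (m + n) (c + d) := by
  have h : u * v ∈ gradedFil m c * gradedFil n d := Submodule.mul_mem_mul hu hv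
  rw [gradedFil, gradedFil, Submodule.span_mul_span] at h
  refine Submodule.span_mono ?_ h
  rintro _ ⟨_, ⟨l, hl, hc, rfl⟩, _, ⟨l', hl', hd, rfl⟩, rfl⟩
  exact ⟨l ++ l', by simp; omega, by simp [hc, hd], by simp⟩

theorem incl_bracket_mem_gradedFil (x y : Gen) :
    incl (bracket x y) ∈ gradedFil 1 (deg x + deg y) := by
  refine map_mem_of_mem_spanOf incl _ (fun z hz => ?_) (bracket_mem_spanOf_deg x y)
  rw [incl_e, ← hz]
  simpa using prod_mem_gradedFil [z]

/-- A version of `move_back` that keeps track of the degree: brackets shorten a word without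
changing its degree. -/
theorem move_back_graded (x : Gen) (l : List Gen) :
    ∃ s : ℂ, g x * (l.map g).prod - s • ((l.map g).prod * g x) ∈
      gradedFil l.length (deg x + wordDeg l) := by
  induction l with
  | nil => exact ⟨1, by simp⟩
  | cons y l ih =>
    obtain ⟨s, hs⟩ := ih
    refine ⟨s * koszul x y, ?_⟩
    have h0 : g y ∈ gradedFil 1 (deg y) := by simpa using prod_mem_gradedFil [y]
    have h1 := Submodule.smul_mem _ (koszul x y) (gradedFil_mul h0 hs)
    have h2 := gradedFil_mul (incl_bracket_mem_gradedFil x y) (prod_mem_gradedFil l)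
    rw [show deg y + (deg x + wordDeg l) = deg x + deg y + wordDeg l by ring] at h1
    have h3 := add_mem h1 h2
    rw [List.length_cons, add_comm l.length, wordDeg_cons, ← add_assoc (deg x)]
    convert h3 using 1
    have h4 : g x * (g y * (l.map g).prod) =
        koszul x y • (g y * (g x * (l.map g).prod)) + incl (bracket x y) * (l.map g).prod := by
      rw [← mul_assoc, g_mul, add_mul, smul_mul_assoc, mul_assoc]
    simp only [List.map_cons, List.prod_cons, mul_sub, mul_smul_comm, h4, mul_assoc]
    module

/-! ### The highest weight vector -/

section Vacuum

variable (lam : Fin 4 → ℂ)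

theorem smul_vacuum_eq_zero_iff (u : U) : u • vacuum lam = 0 ↔ u ∈ vermaIdeal lam := by
  rw [vacuum, ← Submodule.Quotient.mk_smul, smul_eq_mul, mul_one, Submodule.Quotient.mk_eq_zero]

theorem g_smul_vacuum_of_isPos {x : Gen} (hx : IsPos x) : g x • vacuum lam = 0 :=
  (smul_vacuum_eq_zero_iff lam _).2 (Submodule.subset_span (Or.inl ⟨x, hx, rfl⟩))

theorem cartan_smul_vacuum (i : Fin 4) : g (cartan i) • vacuum lam = lam i • vacuum lam := by
  have h := (smul_vacuum_eq_zero_iff lam _).2 (Submodule.subset_span (Or.inr ⟨i, rfl⟩))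
  rwa [sub_smul, sub_eq_zero, algebraMap_smul] at h

/-- The elements of `U(𝔤)` that act on the highest weight vector like those of degree `d ≥ 0`:
by a scalar, which is zero if `d` is positive. -/
def scalarAction (d : ℤ) : Submodule ℂ U where
  carrier := {u | (0 < d → u • vacuum lam = 0) ∧ ∃ s : ℂ, u • vacuum lam = s • vacuum lam}
  zero_mem' := ⟨fun _ => zero_smul _ _, 0, by simp⟩
  add_mem' := by
    rintro u v ⟨h1, s, h2⟩ ⟨h3, t, h4⟩
    exact ⟨fun h => by rw [add_smul, h1 h, h3 h, add_zero], s + t, by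
      rw [add_smul, h2, h4, add_smul]⟩
  smul_mem' := by
    rintro c u ⟨h1, s, h2⟩
    exact ⟨fun h => by rw [smul_assoc, h1 h, smul_zero], c * s, by
      rw [smul_assoc, h2, smul_smul]⟩

theorem prod_mem_scalarAction_of_not_isPos (l : List Gen) (hl : ∀ x ∈ l, ¬ IsPos x)
    (hd : 0 ≤ wordDeg l) : (l.map g).prod ∈ scalarAction lam (wordDeg l) := by
  induction l with
  | nil => exact ⟨fun h => absurd h (lt_irrefl _), 1, by simp⟩
  | cons x l ih =>
    have hl' : ∀ y ∈ l, ¬ IsPos y := fun y hy => hl y (List.mem_cons_of_mem _ hy)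
    have h1 : deg x ≤ 0 := by simpa [isPos_iff_deg] using hl x List.mem_cons_self
    have h2 : wordDeg l ≤ 0 := wordDeg_nonpos l hl'
    rw [wordDeg_cons] at hd ⊢
    obtain ⟨i, rfl⟩ := exists_cartan_of_deg_eq_zero (x := x) (by omega)
    obtain ⟨-, s, hs⟩ := ih hl' (by omega)
    refine ⟨fun h => by omega, s * lam i, ?_⟩
    rw [List.map_cons, List.prod_cons, mul_smul, hs, smul_comm, cartan_smul_vacuum, smul_smul]

/-- A positive letter can be moved to the far right, where it kills the vacuum, at the cost of
shorter words of the same degree. Without positive letters, nonnegative total degree leaves only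
letters of degree zero. These lie in `𝔤₀`, as no `Q` has degree zero, and act by scalars. -/
theorem gradedFil_le_scalarAction (n : ℕ) {d : ℤ} (hd : 0 ≤ d) :
    gradedFil n d ≤ scalarAction lam d := by
  induction n with
  | zero =>
    refine Submodule.span_le.2 ?_
    rintro _ ⟨l, hl, rfl, rfl⟩
    obtain rfl : l = [] := by simpa using hl
    exact prod_mem_scalarAction_of_not_isPos lam [] (by simp) le_rfl
  | succ n ih =>
    refine Submodule.span_le.2 ?_
    rintro _ ⟨l, hl, rfl, rfl⟩
    by_cases h : ∃ x ∈ l, IsPos x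
    · obtain ⟨x, hx, hx'⟩ := h
      obtain ⟨l₁, l₂, rfl⟩ := List.append_of_mem hx
      obtain ⟨s, hs⟩ := move_back_graded x l₂
      have h1 := gradedFil_mul (prod_mem_gradedFil l₁) hs
      rw [← wordDeg_cons, ← wordDeg_append] at h1
      have h2 := ih (gradedFil_mono (by simp at hl; omega) _ h1)
      have h3 : s • ((l₁.map g).prod * (l₂.map g).prod * g x) ∈
          scalarAction lam (wordDeg (l₁ ++ x :: l₂)) := by
        refine Submodule.smul_mem _ _ ?_
        have h4 : ((l₁.map g).prod * (l₂.map g).prod * g x) • vacuum lam = 0 := by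
          rw [mul_smul, g_smul_vacuum_of_isPos lam hx', smul_zero]
        exact ⟨fun _ => h4, 0, by rw [h4, zero_smul]⟩
      convert add_mem h2 h3 using 1
      simp [mul_sub, mul_assoc]
    · push Not at h
      exact prod_mem_scalarAction_of_not_isPos lam l h hd

/-- Words of positive degree kill the highest weight vector. -/
theorem prod_smul_vacuum_of_pos {l : List Gen} (hl : 0 < wordDeg l) :
    (l.map g).prod • vacuum lam = 0 :=
  (gradedFil_le_scalarAction lam _ hl.le (prod_mem_gradedFil l)).1 hl

/-- Words of degree zero map the highest weight vector to a multiple of itself. -/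
theorem exists_prod_smul_vacuum {l : List Gen} (hl : wordDeg l = 0) :
    ∃ s : ℂ, (l.map g).prod • vacuum lam = s • vacuum lam :=
  (gradedFil_le_scalarAction lam _ hl.ge (prod_mem_gradedFil l)).2

theorem cartan_mul_prod_smul_vacuum {l : List Gen} (hl : wordDeg l = 0) (i : Fin 4) :
    (g (cartan i) * (l.map g).prod) • vacuum lam = lam i • (l.map g).prod • vacuum lam := by
  obtain ⟨s, hs⟩ := exists_prod_smul_vacuum lam hl
  rw [mul_smul, hs, smul_comm, cartan_smul_vacuum, smul_comm]

/-! ### The vacuum functional -/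

/-- `u - s` lies in the left ideal of the Verma module, on which the vacuum functional vanishes
after any left multiplication. This is how a block on the right is replaced by a number. -/
theorem vac_mul_of_smul_vacuum {a u : U} {s : ℂ} (h : u • vacuum lam = s • vacuum lam) :
    vac lam (a * u) = s * vac lam a := by
  have h1 : u - algebraMap ℂ U s ∈ vermaIdeal lam := by
    rw [← smul_vacuum_eq_zero_iff, sub_smul, h, algebraMap_smul, sub_self]
  have h2 := vac_mul_mem lam a _ h1
  rw [mul_sub, map_sub, sub_eq_zero] at h2
  rw [h2, ← Algebra.commutes, ← Algebra.smul_def, map_smul, smul_eq_mul]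

theorem vac_one : vac lam 1 = 1 := by
  have h := isHarishChandra_harishChandra.id_on 0
  rw [show cartanMonomial 0 = 1 by simp [cartanMonomial]] at h
  simp [vac, h]

theorem anti_pow (u : U) (n : ℕ) : anti (u ^ n) = anti u ^ n := by
  induction n with
  | zero => simp
  | succ n ih => rw [pow_succ, anti_mul, ih, pow_succ']

theorem anti_cartanMonomial (a : Fin 4 → ℕ) : anti (cartanMonomial a) = cartanMonomial a := by
  have h : ∀ i j, Commute (g (cartan i) ^ a i) (g (cartan j) ^ a j) := fun i j =>
    Commute.pow_pow (cartan_comm i j) _ _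
  simp only [cartanMonomial, anti_mul, anti_pow, anti_g, bar_cartan]
  rw [(h 1 0).eq, ((h 2 0).mul_right (h 2 1)).eq,
    (((h 3 0).mul_right (h 3 1)).mul_right (h 3 2)).eq]

/-- The vacuum functional is invariant under the anti-involution. -/
theorem vac_anti (u : U) : vac lam (anti u) = vac lam u := by
  have hP := isHarishChandra_harishChandra
  suffices h : harishChandra (anti u) = harishChandra u by simp [vac, h]
  induction mem_span_triSet u using Submodule.span_induction with
  | zero => simp
  | add u v _ _ hu hv => simp [hu, hv]
  | smul c u _ hu => simp [hu]
  | mem u hu =>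
    rcases hu with ⟨a, rfl⟩ | ⟨x, v, hx, rfl⟩ | ⟨x, v, hx, rfl⟩
    · rw [anti_cartanMonomial]
    · have hx' : IsPos (bar x) := by
        cases x <;> simp [IsNeg, IsPos, bar] at * <;> omega
      rw [hP.neg_mul x hx, anti_mul, anti_g, hP.mul_pos _ _ hx']
    · rw [hP.mul_pos _ x hx, anti_mul, anti_g, hP.neg_mul _ ((isPos_iff_bar x).2 hx)]

end Vacuum

/-! ### The pairing of the `M` with the `L` -/

theorem M_comm_M (m n : ℤ) : Commute (g (.M m)) (g (.M n)) := by
  rw [Commute, SemiconjBy, g_mul]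
  simp [koszul, bracket]

theorem M_comm_Q (m k : ℤ) : Commute (g (.M m)) (g (.Q k)) := by
  rw [Commute, SemiconjBy, g_mul]
  simp [koszul, bracket]

theorem c₂_comm (x : Gen) : Commute (g .c₂) (g x) := by
  rw [Commute, SemiconjBy, g_mul]
  simp [koszul, bracket]

/-- The product of the `M_n` over a list of positive integers. -/
def raiseM (S : List ℕ+) : U := (S.map fun n : ℕ+ => g (.M (n : ℤ))).prod

/-- The product of the `L_{-n}` over a list of positive integers. -/
def lowerL (T : List ℕ+) : U := (T.map fun n : ℕ+ => g (.L (-(n : ℤ)))).prod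

/-- The sum of a list of positive integers. -/
def total (S : List ℕ+) : ℤ := (S.map fun n : ℕ+ => (n : ℤ)).sum

@[simp] theorem total_nil : total [] = 0 := rfl

@[simp] theorem total_cons (n : ℕ+) (S : List ℕ+) : total (n :: S) = n + total S := rfl

@[simp] theorem raiseM_nil : raiseM [] = 1 := rfl

@[simp] theorem raiseM_cons (n : ℕ+) (S : List ℕ+) :
    raiseM (n :: S) = g (.M (n : ℤ)) * raiseM S := rfl

@[simp] theorem lowerL_nil : lowerL [] = 1 := rfl

@[simp] theorem lowerL_cons (n : ℕ+) (S : List ℕ+) :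
    lowerL (n :: S) = g (.L (-(n : ℤ))) * lowerL S := rfl

theorem commute_list_prod {α : Type*} {u : U} {f : α → U} (h : ∀ a, Commute u (f a))
    (l : List α) : Commute u (l.map f).prod := by
  refine Commute.list_prod_right _ _ fun v hv => ?_
  obtain ⟨a, -, rfl⟩ := List.mem_map.1 hv
  exact h a

theorem smul_smul_of_commute {V : Type*} [AddCommGroup V] [Module U V] {a b : U}
    (h : Commute a b) (v : V) : a • b • v = b • a • v := by
  rw [← mul_smul, h.eq, mul_smul]

theorem M_comm_raiseM (m : ℤ) (S : List ℕ+) : Commute (g (.M m)) (raiseM S) :=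
  commute_list_prod (fun _ => M_comm_M m _) S

theorem raiseM_perm {S S' : List ℕ+} (h : S.Perm S') : raiseM S = raiseM S' := by
  induction h with
  | nil => rfl
  | cons x _ ih => simp [ih]
  | swap x y l => simp only [raiseM_cons, ← mul_assoc, (M_comm_M _ _).eq]
  | trans _ _ h1 h2 => exact h1.trans h2

/-- The word `M_S M_R L_{-T}`, as a list of basis vectors. -/
def wordML (S R T : List ℕ+) : List Gen :=
  (S.map fun n : ℕ+ => .M (n : ℤ)) ++ ((R.map fun n : ℕ+ => .M (n : ℤ)) ++ T.map fun n : ℕ+ => .L (-(n : ℤ)))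

theorem prod_wordML (S R T : List ℕ+) :
    ((wordML S R T).map g).prod = raiseM S * (raiseM R * lowerL T) := by
  simp [wordML, raiseM, lowerL, Function.comp_def]

theorem wordDeg_wordML (S R T : List ℕ+) :
    wordDeg (wordML S R T) = 2 * (total S + total R - total T) := by
  have h1 : ∀ S : List ℕ+, wordDeg (S.map fun n : ℕ+ => .M (n : ℤ)) = 2 * total S := fun S => by
    induction S with
    | nil => rfl
    | cons n S ih => simp [deg] at *; rw [ih]; ring
  have h2 : ∀ S : List ℕ+, wordDeg (S.map fun n : ℕ+ => .L (-(n : ℤ))) = -2 * total S := fun S => by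
    induction S with
    | nil => rfl
    | cons n S ih => simp [deg] at *; rw [ih]; ring
  rw [wordML, wordDeg_append, wordDeg_append, h1, h1, h2]
  ring

theorem M_mul_L (s t : ℤ) : g (.M s) * g (.L (-t)) = g (.L (-t)) * g (.M s) +
    (((s : ℂ) + t) • g (.M (s - t)) +
      (if s = t then ((t : ℂ) ^ 3 - t) / 12 else 0) • g .c₂) := by
  rw [g_mul]
  simp only [koszul, bracket, brLM, map_neg, map_add, map_smul, incl_e, one_smul]
  rw [show -t + s = s - t by ring]
  by_cases h : s = t
  · subst h
    simp only [sub_self, if_true]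
    push_cast
    module
  · rw [if_neg h, if_neg (by omega)]
    push_cast
    module

/-- The value `n (2 h₂ + (n² - 1) / 12 c₂)`. -/
def levelML (lam : Fin 4 → ℂ) (n : ℂ) : ℂ := n * (2 * lam 1 + (n ^ 2 - 1) / 12 * lam 3)

variable (lam : Fin 4 → ℂ)

theorem raiseM_mul_lowerL_smul_vacuum_of_lt {S R T : List ℕ+}
    (h : total T < total S + total R) :
    raiseM S • raiseM R • lowerL T • vacuum lam = 0 := by
  have h1 := prod_smul_vacuum_of_pos lam (l := wordML S R T) (by rw [wordDeg_wordML]; omega)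
  rwa [prod_wordML, mul_smul, mul_smul] at h1

/-- Moving `L_{-t}` to the left of a product of `M_s` with `s ≤ t`. -/
theorem raiseM_smul_L_smul (t : ℕ+) (T S R : List ℕ+) (hS : ∀ s ∈ S, s ≤ t)
    (h : total S + total R = t + total T) :
    raiseM S • g (.L (-(t : ℤ))) • raiseM R • lowerL T • vacuum lam =
      (S.count t * levelML lam t) • raiseM (S.erase t) • raiseM R • lowerL T • vacuum lam := by
  have htp : (0 : ℤ) < t := by exact_mod_cast t.pos
  -- The letters of `S` that have passed `L_{-t}` collect in `R`. When `S` is exhausted, `R` exceeds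
  -- `T` by `t` in degree and the vector is zero.
  induction S generalizing R with
  | nil =>
    have h1 : raiseM R • lowerL T • vacuum lam = 0 := by
      rw [total_nil, zero_add] at h
      simpa using raiseM_mul_lowerL_smul_vacuum_of_lt lam (S := []) (R := R) (T := T)
        (by rw [total_nil]; omega)
    simp [h1]
  | cons s S ih =>
    have hS' : ∀ s ∈ S, s ≤ t := fun s hs => hS s (List.mem_cons_of_mem _ hs)
    have hst : s ≤ t := hS s List.mem_cons_self
    have h1 := ih (s :: R) hS' (by simp at *; omega)
    set v := raiseM R • lowerL T • vacuum lam with hv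
    have h2 : raiseM (s :: S) • g (.L (-(t : ℤ))) • v =
        raiseM S • g (.L (-(t : ℤ))) • raiseM (s :: R) • lowerL T • vacuum lam +
        raiseM S • (((s : ℂ) + t) • g (.M ((s : ℤ) - t)) +
          (if (s : ℤ) = t then ((t : ℂ) ^ 3 - t) / 12 else 0) • g .c₂) • v := by
      rw [raiseM_cons, (M_comm_raiseM _ _).eq, mul_smul, ← mul_smul (g (.M (s : ℤ))), M_mul_L,
        add_smul, smul_add, mul_smul, raiseM_cons, mul_smul (g (.M (s : ℤ)))]
      push_cast
      rfl
    have hsR : raiseM (s :: R) • lowerL T • vacuum lam = g (.M (s : ℤ)) • v := mul_smul _ _ _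
    rw [h2, h1, hsR]
    -- For `s = t` the commutator is `2t M₀ + (t³ - t)/12 c₂`, which contributes one more `levelML
    -- lam t`. For `s < t` it is a multiple of `M_{s-t}`; commuted to the front, it stands before a
    -- product of positive degree on the vacuum.
    rcases eq_or_lt_of_le hst with rfl | hlt
    · rw [total_cons] at h
      have hdeg : wordDeg (wordML S R T) = 0 := by rw [wordDeg_wordML]; omega
      have h3 := cartan_mul_prod_smul_vacuum lam hdeg 1
      have h4 := cartan_mul_prod_smul_vacuum lam hdeg 3
      rw [prod_wordML, mul_smul, mul_smul, mul_smul, ← hv] at h3 h4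
      -- `v` itself need not have degree zero, but `raiseM S • v` has, so `M₀` is first moved in
      -- front of `raiseM S`.
      have h5 : raiseM S • g (.M 0) • v = lam 1 • raiseM S • v := by
        rw [← h3, ← mul_smul, ← (M_comm_raiseM _ _).eq, mul_smul]
        rfl
      have h6 : raiseM S • g .c₂ • v = lam 3 • raiseM S • v := by
        have h7 : Commute (g .c₂) (raiseM S) :=
          commute_list_prod (fun n : ℕ+ => c₂_comm (.M (n : ℤ))) S
        rw [← h4, ← mul_smul, ← h7.eq, mul_smul]
        rfl
      have h7 : ((S.count s : ℂ) * levelML lam s) • raiseM (S.erase s) •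
          g (.M (s : ℤ)) • v = ((S.count s : ℂ) * levelML lam s) • raiseM S • v := by
        by_cases hs : s ∈ S
        · rw [← smul_smul_of_commute (M_comm_raiseM _ _), ← mul_smul (g (.M (s : ℤ))),
            ← raiseM_cons, ← raiseM_perm (List.perm_cons_erase hs)]
        · simp [List.count_eq_zero_of_not_mem hs]
      rw [h7, List.erase_cons_head, List.count_cons_self, if_pos rfl, sub_self, add_smul, smul_add,
        smul_assoc, smul_assoc, smul_comm (raiseM S) (_ : ℂ) (_ : Verma lam),
        smul_comm (raiseM S) (_ : ℂ) (_ : Verma lam), h5, h6, levelML]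
      generalize raiseM S • v = x
      push_cast
      module
    · rw [total_cons] at h
      have hlt' : (s : ℤ) < t := by exact_mod_cast hlt
      have h3 : raiseM S • g (.M ((s : ℤ) - t)) • v = 0 := by
        rw [← mul_smul, ← (M_comm_raiseM _ _).eq, mul_smul, hv,
          raiseM_mul_lowerL_smul_vacuum_of_lt lam (by omega), smul_zero]
      rw [if_neg hlt'.ne, zero_smul, add_zero, smul_assoc, smul_comm (raiseM S) (_ : ℂ) (_ : Verma lam), h3, smul_zero,
        add_zero, List.count_cons_of_ne hlt.ne, List.erase_cons_tail (by simpa using hlt.ne),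
        ← smul_smul_of_commute (M_comm_raiseM _ _), ← mul_smul (g (.M (s : ℤ))), ← raiseM_cons]

/-- Equality of the two lists up to order gives the diagonal value of the pairing. -/
theorem raiseM_smul_lowerL_smul_vacuum_of_perm {S T : List ℕ+} (hT : T.Pairwise (· ≥ ·))
    (h : S.Perm T) (F : Finset ℕ+) (hF : ∀ t ∈ T, t ∈ F) :
    raiseM S • lowerL T • vacuum lam =
      (∏ n ∈ F, ((T.count n).factorial : ℂ) * levelML lam n ^ T.count n) • vacuum lam := by
  -- The product runs over a fixed `F` containing `T`, so its range stays the same as letters are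
  -- removed; indices outside `T` contribute `0! · x⁰ = 1`.
  induction T generalizing S with
  | nil =>
    obtain rfl := h.eq_nil
    simp
  | cons t T ih =>
    have hle : ∀ s ∈ S, s ≤ t := fun s hs => by
      rcases List.mem_cons.1 (h.subset hs) with rfl | hs
      · exact le_rfl
      · exact List.rel_of_pairwise_cons hT hs
    have htot : total S = t + total T := by
      rw [total, (h.map _).sum_eq]
      rfl
    have h1 := raiseM_smul_L_smul lam t T S [] hle (by simpa using htot)
    have h2 : (S.erase t).Perm T := by simpa using h.erase t
    rw [raiseM_nil, one_smul] at h1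
    rw [lowerL_cons, mul_smul, h1, ih hT.of_cons h2 fun s hs => hF s (List.mem_cons_of_mem _ hs),
      smul_smul, h.count_eq, List.count_cons_self]
    congr 1
    have ht := hF t List.mem_cons_self
    rw [← Finset.mul_prod_erase F _ ht, ← Finset.mul_prod_erase F _ ht, List.count_cons_self,
      Nat.factorial_succ, pow_succ]
    have h3 : ∀ n ∈ F.erase t, ((t :: T).count n) = T.count n := fun n hn =>
      List.count_cons_of_ne (Finset.ne_of_mem_erase hn).symm
    rw [Finset.prod_congr rfl fun (n : ℕ+) hn => congrArg
      (fun k => (k.factorial : ℂ) * levelML lam (n : ℕ) ^ k) (h3 n hn)]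
    push_cast
    ring

/-- The pairing vanishes if `T` is larger than `S` in the lexicographical order. -/
theorem raiseM_smul_lowerL_smul_vacuum_of_lex {S T : List ℕ+} (hT : T.Pairwise (· ≥ ·))
    (htot : total S = total T) (r : ℕ+) (hr : S.count r < T.count r)
    (hr' : ∀ s, r < s → S.count s = T.count s) :
    raiseM S • lowerL T • vacuum lam = 0 := by
  induction T generalizing S with
  | nil => simp at hr
  | cons t T ih =>
    have hmem : ∀ s ∈ t :: T, s ≤ t := fun s hs => by
      rcases List.mem_cons.1 hs with rfl | hs
      · exact le_rfl
      · exact List.rel_of_pairwise_cons hT hs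
    have hrt : r ≤ t := hmem r (List.count_pos_iff.1 (by omega))
    -- A letter of `S` above `t ≥ r` would occur equally often in `t :: T`, whose maximum is `t`.
    have hle : ∀ s ∈ S, s ≤ t := fun s hs => by
      by_contra hst
      have h1 := hr' s (hrt.trans_lt (not_le.1 hst))
      have h2 := List.count_pos_iff.2 hs
      exact hst (hmem s (List.count_pos_iff.1 (by omega)))
    have h1 := raiseM_smul_L_smul lam t T S [] hle (by simpa using htot)
    rw [raiseM_nil, one_smul] at h1
    rw [lowerL_cons, mul_smul, h1]
    -- If `t` occurs in `S`, one copy is cancelled on both sides and the comparison at `r` persists.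
    -- If not, the factor `S.count t` is zero.
    by_cases ht : t ∈ S
    · have hp := List.perm_cons_erase ht
      have htot' : total S = t + total (S.erase t) := by
        rw [total, (hp.map _).sum_eq]
        rfl
      rw [total_cons] at htot
      have hc : ∀ s, S.count s = (t :: S.erase t).count s := fun s => hp.count_eq s
      rw [ih hT.of_cons (by omega), smul_zero]
      · rw [hc, List.count_cons, List.count_cons] at hr
        omega
      · intro s hs
        have h2 := hr' s hs
        rw [hc, List.count_cons, List.count_cons] at h2
        omega
    · simp [List.count_eq_zero_of_not_mem ht]

/-! ### The pairing of the `Q` -/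

/-- The product of the `Q_{n-1/2}` over the reverse of a list of positive integers. -/
def raiseQ (S : List ℕ+) : U := (S.reverse.map fun n : ℕ+ => g (.Q ((n : ℤ) - 1))).prod

/-- The product of the `Q_{-n+1/2}` over a list of positive integers. -/
def lowerQ (S : List ℕ+) : U := (S.map fun n : ℕ+ => g (.Q (-(n : ℤ)))).prod

@[simp] theorem raiseQ_nil : raiseQ [] = 1 := rfl

@[simp] theorem raiseQ_cons (n : ℕ+) (S : List ℕ+) :
    raiseQ (n :: S) = raiseQ S * g (.Q ((n : ℤ) - 1)) := by
  simp [raiseQ]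

@[simp] theorem lowerQ_nil : lowerQ [] = 1 := rfl

@[simp] theorem lowerQ_cons (n : ℕ+) (S : List ℕ+) :
    lowerQ (n :: S) = g (.Q (-(n : ℤ))) * lowerQ S := rfl

theorem M_comm_lowerQ (m : ℤ) (S : List ℕ+) : Commute (g (.M m)) (lowerQ S) :=
  commute_list_prod (f := fun n : ℕ+ => g (.Q (-(n : ℤ)))) (fun _ => M_comm_Q m _) S

theorem M_comm_raiseQ (m : ℤ) (S : List ℕ+) : Commute (g (.M m)) (raiseQ S) :=
  commute_list_prod (f := fun n : ℕ+ => g (.Q ((n : ℤ) - 1))) (fun _ => M_comm_Q m _) S.reverse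

theorem c₂_comm_lowerQ (S : List ℕ+) : Commute (g .c₂) (lowerQ S) :=
  commute_list_prod (f := fun n : ℕ+ => g (.Q (-(n : ℤ)))) (fun _ => c₂_comm _) S

theorem Q_mul_Q (n m : ℤ) : g (.Q (n - 1)) * g (.Q (-m)) = -(g (.Q (-m)) * g (.Q (n - 1))) +
    ((2 : ℂ) • g (.M (n - m)) +
      (if n = m then (4 * ((n : ℂ) - 1 / 2) ^ 2 - 1) / 12 else 0) • g .c₂) := by
  rw [g_mul]
  simp only [koszul, bracket, brQQ, map_add, map_smul, incl_e, neg_smul, one_smul]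
  rw [show n - 1 + -m + 1 = n - m by ring]
  by_cases h : n = m
  · rw [if_pos h, if_pos (by omega)]
    push_cast
    module
  · rw [if_neg h, if_neg (by omega)]

/-- The value `2 h₂ + (4 (n - 1/2)² - 1) / 12 c₂`. -/
def levelQ (n : ℂ) : ℂ := 2 * lam 1 + (4 * (n - 1 / 2) ^ 2 - 1) / 12 * lam 3

/-- The sum of `2 n - 1` over a list of positive integers. -/
def totalQ (S : List ℕ+) : ℤ := (S.map fun n : ℕ+ => 2 * (n : ℤ) - 1).sum

theorem raiseQ_smul_lowerQ_smul_vacuum_of_lt {S T : List ℕ+} (h : totalQ T < totalQ S) :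
    raiseQ S • lowerQ T • vacuum lam = 0 := by
  have h1 : ∀ S : List ℕ+, wordDeg (S.map fun n : ℕ+ => .Q ((n : ℤ) - 1)) = totalQ S := fun S => by
    induction S with
    | nil => rfl
    | cons n S ih => simp [deg, totalQ] at *; rw [ih]; ring
  have h2 : ∀ S : List ℕ+, wordDeg (S.map fun n : ℕ+ => .Q (-(n : ℤ))) = -totalQ S := fun S => by
    induction S with
    | nil => rfl
    | cons n S ih => simp [deg, totalQ] at *; rw [ih]; ring
  have h3 : totalQ S.reverse = totalQ S := by simp [totalQ]
  have h4 := prod_smul_vacuum_of_pos lam (l := (S.reverse.map fun n : ℕ+ => .Q ((n : ℤ) - 1)) ++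
    T.map fun n : ℕ+ => .Q (-(n : ℤ))) (by rw [wordDeg_append, h1, h2, h3]; omega)
  rw [List.map_append, List.prod_append, mul_smul, List.map_map, List.map_map] at h4
  exact h4

/-- Each anticommutator is `2 M_{n-m}` with `n > m`, which commutes with the remaining `Q` and kills
the vacuum. -/
theorem Q_smul_lowerQ_smul_vacuum (n : ℕ+) (T : List ℕ+) (hT : ∀ m ∈ T, m < n) :
    g (.Q ((n : ℤ) - 1)) • lowerQ T • vacuum lam = 0 := by
  have hn : (0 : ℤ) < n := by exact_mod_cast n.pos
  induction T with
  | nil =>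
    rw [lowerQ_nil, one_smul]
    exact g_smul_vacuum_of_isPos lam (by simp only [IsPos]; omega)
  | cons m T ih =>
    have hm : (m : ℤ) < n := by exact_mod_cast hT m List.mem_cons_self
    rw [lowerQ_cons, mul_smul, ← mul_smul, Q_mul_Q, if_neg hm.ne', zero_smul, add_zero, add_smul,
      neg_smul, mul_smul, ih fun m hm => hT m (List.mem_cons_of_mem _ hm), smul_zero, neg_zero,
      zero_add, smul_assoc, smul_smul_of_commute (M_comm_lowerQ _ _),
      g_smul_vacuum_of_isPos lam (by simp only [IsPos]; omega), smul_zero, smul_zero]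

theorem Q_smul_Q_smul_lowerQ_smul_vacuum (n : ℕ+) (T : List ℕ+) (hT : ∀ m ∈ T, m < n) :
    g (.Q ((n : ℤ) - 1)) • lowerQ (n :: T) • vacuum lam =
      levelQ lam n • lowerQ T • vacuum lam := by
  have h1 : g (.M 0) • vacuum lam = lam 1 • vacuum lam := cartan_smul_vacuum lam 1
  have h2 : g .c₂ • vacuum lam = lam 3 • vacuum lam := cartan_smul_vacuum lam 3
  rw [lowerQ_cons, mul_smul, ← mul_smul, Q_mul_Q, if_pos rfl, add_smul, neg_smul, mul_smul,
    Q_smul_lowerQ_smul_vacuum lam n T hT, smul_zero, neg_zero, zero_add, add_smul, smul_assoc,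
    smul_assoc, smul_smul_of_commute (M_comm_lowerQ _ _), smul_smul_of_commute (c₂_comm_lowerQ _),
    sub_self, h1, h2, smul_comm (lowerQ T) (_ : ℂ) (_ : Verma lam),
    smul_comm (lowerQ T) (_ : ℂ) (_ : Verma lam), levelQ]
  generalize lowerQ T • vacuum lam = x
  push_cast
  module

theorem raiseQ_smul_lowerQ_smul_vacuum_self {T : List ℕ+} (hT : T.Pairwise (· > ·))
    (F : Finset ℕ+) (hF : ∀ t ∈ T, t ∈ F) :
    raiseQ T • lowerQ T • vacuum lam = (∏ n ∈ F, levelQ lam n ^ T.count n) • vacuum lam := by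
  induction T with
  | nil => simp
  | cons t T ih =>
    have hlt : ∀ m ∈ T, m < t := fun m hm => List.rel_of_pairwise_cons hT hm
    have ht := hF t List.mem_cons_self
    rw [raiseQ_cons, mul_smul, Q_smul_Q_smul_lowerQ_smul_vacuum lam t T hlt,
      smul_comm (raiseQ T) (_ : ℂ) (_ : Verma lam), ih hT.of_cons fun s hs =>
      hF s (List.mem_cons_of_mem _ hs), smul_smul]
    congr 1
    rw [← Finset.mul_prod_erase F _ ht, ← Finset.mul_prod_erase F _ ht, List.count_cons_self,
      pow_succ]
    have h3 : ∀ n ∈ F.erase t, ((t :: T).count n) = T.count n := fun n hn =>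
      List.count_cons_of_ne (Finset.ne_of_mem_erase hn).symm
    rw [Finset.prod_congr rfl fun (n : ℕ+) hn => congrArg
      (fun k => levelQ lam (n : ℕ) ^ k) (h3 n hn)]
    ring

/-- The pairing vanishes if `S` is larger than `T` in the lexicographical order. -/
theorem raiseQ_smul_lowerQ_smul_vacuum_of_lex {S T : List ℕ+} (hS : S.Pairwise (· > ·))
    (hT : T.Pairwise (· > ·)) (r : ℕ+) (hr : T.count r < S.count r)
    (hr' : ∀ s, r < s → T.count s = S.count s) :
    raiseQ S • lowerQ T • vacuum lam = 0 := by
  induction S generalizing T with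
  | nil => simp at hr
  | cons n S ih =>
    have hSn : ∀ m ∈ S, m < n := fun m hm => List.rel_of_pairwise_cons hS hm
    have hle : ∀ m ∈ n :: S, m ≤ n := fun m hm => by
      rcases List.mem_cons.1 hm with rfl | hm
      · exact le_rfl
      · exact (hSn m hm).le
    have hrn : r ≤ n := hle r (List.count_pos_iff.1 (by omega))
    have hTn : ∀ m ∈ T, m ≤ n := fun m hm => by
      by_contra hmn
      have h1 := hr' m (hrn.trans_lt (not_le.1 hmn))
      have h2 := List.count_pos_iff.2 hm
      exact hmn (hle m (List.count_pos_iff.1 (by omega)))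
    rw [raiseQ_cons, mul_smul]
    -- No letter of `T` exceeds `n`. If `n` occurs in `T`, it is the head, and both heads contract
    -- to a scalar; otherwise `Q_{n-1/2}` already kills the vector. Unlike the pairing of `M` with
    -- `L`, no equality of degrees is needed.
    by_cases h : n ∈ T
    · obtain ⟨m, T, rfl⟩ := List.exists_cons_of_ne_nil (List.ne_nil_of_mem h)
      have hTm : ∀ s ∈ T, s < m := fun s hs => List.rel_of_pairwise_cons hT hs
      obtain rfl : m = n := by
        rcases List.mem_cons.1 h with rfl | h
        · rfl
        · exact absurd (hTm n h) (not_lt.2 (hTn m List.mem_cons_self))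
      rw [Q_smul_Q_smul_lowerQ_smul_vacuum lam m T hTm,
        smul_comm (raiseQ S) (_ : ℂ) (_ : Verma lam), ih hS.of_cons hT.of_cons, smul_zero]
      · rw [List.count_cons, List.count_cons] at hr
        omega
      · intro s hs
        have h2 := hr' s hs
        rw [List.count_cons, List.count_cons] at h2
        omega
    · rw [Q_smul_lowerQ_smul_vacuum lam n T, smul_zero]
      intro m hm
      exact lt_of_le_of_ne (hTn m hm) fun h' => h (h' ▸ hm)

/-! ### Exponent vectors as lists -/

/-- The descending list in which each index occurs as often as the exponent vector says. -/
def expand (i : Expo) : List ℕ+ :=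
  (i.support.sort (fun a b => b ≤ a)).flatMap fun n => List.replicate (i n) n

theorem pairwise_expand (i : Expo) : (expand i).Pairwise (· ≥ ·) := by
  rw [expand, List.pairwise_flatMap]
  refine ⟨fun n _ => by simp [List.pairwise_replicate], ?_⟩
  refine (Finset.pairwise_sort i.support (fun a b => b ≤ a)).imp fun {a b} h x hx y hy => ?_
  rw [List.eq_of_mem_replicate hx, List.eq_of_mem_replicate hy]
  exact h

theorem count_expand (i : Expo) (n : ℕ+) : (expand i).count n = i n := by
  rw [expand, List.count_flatMap]
  have h : ∀ l : List ℕ+, l.Nodup →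
      (l.map (List.count n ∘ fun m => List.replicate (i m) m)).sum = if n ∈ l then i n else 0 := by
    intro l hl
    induction l with
    | nil => simp
    | cons m l ih =>
      rw [List.map_cons, List.sum_cons, ih hl.of_cons]
      by_cases hm : m = n
      · subst hm
        simp [(List.nodup_cons.1 hl).1]
      · simp [List.count_replicate, hm, Ne.symm hm]
  rw [h _ (Finset.sort_nodup _ _)]
  simp +contextual

theorem mem_expand (i : Expo) (n : ℕ+) : n ∈ expand i ↔ n ∈ i.support := by
  rw [← List.count_pos_iff, count_expand, Finsupp.mem_support_iff, Nat.pos_iff_ne_zero]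

theorem pairwise_gt_expand {i : Expo} (h : ∀ n, i n ≤ 1) : (expand i).Pairwise (· > ·) := by
  have h1 : (expand i).Nodup := List.nodup_iff_count_le_one.2 fun n => by
    rw [count_expand]; exact h n
  exact (List.Pairwise.and (pairwise_expand i) h1).imp fun h => lt_of_le_of_ne h.1 h.2.symm

theorem monomial_eq (f : ℕ+ → U) (i : Expo) : monomial f i = ((expand i).map f).prod := by
  rw [monomial, expand]
  induction i.support.sort (fun a b => b ≤ a) with
  | nil => rfl
  | cons n l ih => simp [ih]

theorem sum_map_expand (i : Expo) (f : ℕ+ → ℚ) :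
    ((expand i).map f).sum = i.sum fun n a => a * f n := by
  have h : (expand i).toFinset = i.support := by
    ext n
    rw [List.mem_toFinset, mem_expand]
  rw [Finset.sum_list_map_count, h]
  simp [count_expand, Finsupp.sum]

theorem total_expand (i : Expo) : (total (expand i) : ℚ) = size i := by
  have h := sum_map_expand i fun n => ((n : ℕ) : ℚ)
  rw [size, ← h, total]
  simp [Function.comp_def]

theorem totalQ_expand (i : Expo) : (totalQ (expand i) : ℚ) = 2 * sizeQ i := by
  have h := sum_map_expand i fun n => 2 * ((n : ℕ) : ℚ) - 1
  rw [totalQ, Int.cast_list_sum, List.map_map]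
  simp only [Function.comp_def]
  push_cast
  rw [h, sizeQ, Finsupp.sum, Finsupp.sum, Finset.mul_sum]
  exact Finset.sum_congr rfl fun _ _ => by ring

theorem anti_prod (f : ℕ+ → U) (l : List ℕ+) :
    anti (l.map f).prod = (l.reverse.map fun n => anti (f n)).prod := by
  induction l with
  | nil => simp
  | cons n l ih => simp [ih]

theorem anti_Mpow (i : Expo) : anti (Mpow i) = raiseM (expand i) := by
  rw [Mpow, monomial_eq, anti_prod, ← raiseM_perm (List.reverse_perm _)]
  simp [raiseM, bar]

theorem anti_Qpow (i : Expo) : anti (Qpow i) = raiseQ (expand i) := by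
  rw [Qpow, monomial_eq, anti_prod]
  simp [raiseQ, bar]

theorem Lpow_eq (i : Expo) : Lpow i = lowerL (expand i) := monomial_eq _ i

theorem Qpow_eq (i : Expo) : Qpow i = lowerQ (expand i) := monomial_eq _ i

/-! ### The entries of the matrix of the form -/

theorem anti_anti_Lpow (i : Expo) : anti (anti (Lpow i)) = Lpow i := by
  rw [Lpow, monomial_eq, anti_prod, anti_prod, List.reverse_reverse]
  simp [bar]

/-- The star places `M^{i'}` next to the `Q` and `L^{j'}` at the right end. Both `M̄^j` and `M^{i'}`
commute with the `Q` block and with each other, so `M̄^j` can meet `L^{j'}` and `M^{i'}` can meet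
`L̄^i`. -/
theorem form_vec_star (x y : Index) :
    form lam (vec lam x) (vec lam y.star) =
      vac lam (anti (Lpow x.i) * Mpow y.i * (raiseQ (expand x.k) * lowerQ (expand y.k)) *
        (raiseM (expand x.j) * lowerL (expand y.j))) := by
  have h1 : Commute (raiseM (expand x.j)) (raiseQ (expand x.k) * lowerQ (expand y.k) *
      Mpow y.i) := by
    refine (commute_list_prod (u := raiseQ (expand x.k) * lowerQ (expand y.k) * Mpow y.i)
      (f := fun n : ℕ+ => g (.M (n : ℤ))) (fun n => Commute.symm ?_) _).symm
    refine ((M_comm_raiseQ _ _).mul_right (M_comm_lowerQ _ _)).mul_right ?_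
    rw [Mpow, monomial_eq]
    exact commute_list_prod (fun _ => M_comm_M _ _) _
  have h2 : Commute (raiseQ (expand x.k) * lowerQ (expand y.k)) (Mpow y.i) := by
    rw [Mpow, monomial_eq]
    exact commute_list_prod
      (fun _ => ((M_comm_raiseQ _ _).mul_right (M_comm_lowerQ _ _)).symm) _
  rw [vec, vec, form_apply, anti_mul, anti_mul, anti_Mpow, anti_Qpow]
  simp only [Index.star]
  rw [Lpow_eq y.j, Qpow_eq y.k]
  congr 1
  calc _ = anti (Lpow x.i) * (raiseM (expand x.j) *
        (raiseQ (expand x.k) * lowerQ (expand y.k) * Mpow y.i)) * lowerL (expand y.j) := by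
        simp only [mul_assoc]
    _ = _ := by rw [h1.eq, h2.eq]; simp only [mul_assoc]

/-- The anti-involution fixes the vacuum value and exchanges the roles of `L` and `M`, so the
pairing computed for `j` serves for `i` with its arguments interchanged. -/
theorem vac_anti_Lpow_mul_Mpow (i i' : Expo) :
    vac lam (anti (Lpow i) * Mpow i') = vac lam (raiseM (expand i') * lowerL (expand i)) := by
  rw [← vac_anti, anti_mul, anti_anti_Lpow, anti_Mpow, Lpow_eq]

theorem vac_of_smul_vacuum {u : U} {s : ℂ} (h : u • vacuum lam = s • vacuum lam) :
    vac lam u = s := by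
  have h1 := vac_mul_of_smul_vacuum lam (a := 1) h
  rwa [one_mul, vac_one, mul_one] at h1

theorem raiseM_expand_of_lex {i j : Expo} (hs : size i = size j) (h : LexGT j i) :
    (raiseM (expand i) * lowerL (expand j)) • vacuum lam = 0 := by
  obtain ⟨r, hr, hr'⟩ := h
  rw [mul_smul]
  refine raiseM_smul_lowerL_smul_vacuum_of_lex lam (pairwise_expand j) ?_ r ?_ ?_
  · exact_mod_cast (total_expand i).trans (hs.trans (total_expand j).symm)
  · simpa only [count_expand] using hr
  · intro s hs
    simpa only [count_expand] using (hr' s hs).symm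

theorem raiseM_expand_self (i : Expo) :
    (raiseM (expand i) * lowerL (expand i)) • vacuum lam =
      (∏ n ∈ i.support, ((i n).factorial : ℂ) * levelML lam n ^ i n) • vacuum lam := by
  rw [mul_smul, raiseM_smul_lowerL_smul_vacuum_of_perm lam (pairwise_expand i) (List.Perm.refl _)
    i.support fun t ht => (mem_expand i t).1 ht]
  simp only [count_expand]

theorem raiseQ_expand_self {k : Expo} (hk : ∀ n, k n ≤ 1) :
    (raiseQ (expand k) * lowerQ (expand k)) • vacuum lam =
      (∏ n ∈ k.support, levelQ lam n ^ k n) • vacuum lam := by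
  rw [mul_smul, raiseQ_smul_lowerQ_smul_vacuum_self lam (pairwise_gt_expand hk)
    k.support fun t ht => (mem_expand k t).1 ht]
  simp only [count_expand]

theorem form_vec_star_eq_zero {x y : Index} (hlen : x.length = y.length) (h : PrincipalGT x y) :
    form lam (vec lam x) (vec lam y.star) = 0 := by
  have hM : (raiseM (expand x.j) * lowerL (expand y.j)) • vacuum lam = 0 →
      form lam (vec lam x) (vec lam y.star) = 0 := fun h0 => by
    rw [form_vec_star, vac_mul_of_smul_vacuum lam (s := 0) (by rw [h0, zero_smul]), zero_mul]
  have hQ : x.j = y.j → (raiseQ (expand x.k) * lowerQ (expand y.k)) • vacuum lam = 0 →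
      form lam (vec lam x) (vec lam y.star) = 0 := fun hj h0 => by
    rw [form_vec_star, ← hj, vac_mul_of_smul_vacuum lam (raiseM_expand_self lam x.j),
      vac_mul_of_smul_vacuum lam (s := 0) (by rw [h0, zero_smul]), zero_mul, mul_zero]
  rcases h with h | ⟨h1, h2⟩ | ⟨hj, h⟩ | ⟨hj, -, r, hr, hr'⟩ | ⟨hj, hk, h⟩
  · refine hM ?_
    rw [← total_expand, ← total_expand] at h
    have h1 : total (expand y.j) < total (expand x.j) := by exact_mod_cast h
    simpa [mul_smul] using raiseM_mul_lowerL_smul_vacuum_of_lt lam (S := expand x.j) (R := [])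
      (T := expand y.j) (by simpa using h1)
  · exact hM (raiseM_expand_of_lex lam h1 h2)
  · refine hQ hj ?_
    have h1 : (totalQ (expand y.k) : ℚ) < totalQ (expand x.k) := by
      rw [totalQ_expand, totalQ_expand]
      linarith
    rw [mul_smul]
    exact raiseQ_smul_lowerQ_smul_vacuum_of_lt lam (by exact_mod_cast h1)
  · refine hQ hj ?_
    rw [mul_smul]
    refine raiseQ_smul_lowerQ_smul_vacuum_of_lex lam (pairwise_gt_expand x.k_le_one)
      (pairwise_gt_expand y.k_le_one) r (by simpa only [count_expand] using hr) fun s hs => ?_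
    simpa only [count_expand] using (hr' s hs).symm
  -- Only here is equality of the total lengths used: the lexicographical vanishing for `M` and `L`
  -- requires equal sizes.
  · have hi : size y.i = size x.i := by
      simp only [Index.length, hj, hk] at hlen
      linarith
    have h0 := raiseM_expand_of_lex lam hi h
    rw [form_vec_star, ← hj, ← hk, vac_mul_of_smul_vacuum lam (raiseM_expand_self lam x.j),
      vac_mul_of_smul_vacuum lam (raiseQ_expand_self lam x.k_le_one), vac_anti_Lpow_mul_Mpow,
      vac_of_smul_vacuum lam (s := 0) (by rw [h0, zero_smul]), mul_zero, mul_zero]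

theorem form_vec_star_self (h₁ h₂ c₁ c₂ : ℂ) (x : Index) :
    form (weight h₁ h₂ c₁ c₂) (vec _ x) (vec _ x.star) = diagEntry h₂ c₂ x := by
  rw [form_vec_star, vac_mul_of_smul_vacuum _ (raiseM_expand_self _ x.j),
    vac_mul_of_smul_vacuum _ (raiseQ_expand_self _ x.k_le_one), vac_anti_Lpow_mul_Mpow,
    vac_of_smul_vacuum _ (raiseM_expand_self _ x.i)]
  simp only [levelML, levelQ, weight, diagEntry, Matrix.cons_val]
  ring

theorem label_length (q : ℚ) (a : Fin (p q)) : (label q a).length = q :=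
  (finite_length q).mem_toFinset.1 (Finset.orderEmbOfFin_mem (labels q) rfl a.rev)

/-- The order embedding of `Fin` is increasing; its precomposition with `Fin.rev` makes the list
decreasing, so the entries above the diagonal are those with the larger label on the left. -/
theorem principalGT_label {q : ℚ} {a b : Fin (p q)} (h : a < b) :
    PrincipalGT (label q a) (label q b) := by
  rw [← gt_iff]
  exact ((labels q).orderEmbOfFin rfl).strictMono (Fin.rev_lt_rev.2 h)

end BMS

end

/-! ### Triangularity and the determinant -/

theorem lemma3p1 (h₁ h₂ c₁ c₂ : ℂ) (N : ℕ) :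
    BMS.IsHarishChandra BMS.harishChandra ∧
    (∀ a b, a < b → BMS.D (BMS.weight h₁ h₂ c₁ c₂) (N / 2) a b = 0) ∧
    (∀ a, BMS.D (BMS.weight h₁ h₂ c₁ c₂) (N / 2) a a =
      BMS.diagEntry h₂ c₂ (BMS.label (N / 2) a)) ∧
    (BMS.D (BMS.weight h₁ h₂ c₁ c₂) (N / 2)).det =
      ∏ a, BMS.diagEntry h₂ c₂ (BMS.label (N / 2) a) := by
  have htri : ∀ a b, a < b → BMS.D (BMS.weight h₁ h₂ c₁ c₂) (N / 2) a b = 0 := fun a b h =>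
    BMS.form_vec_star_eq_zero _ ((BMS.label_length _ a).trans (BMS.label_length _ b).symm)
      (BMS.principalGT_label h)
  have hdiag : ∀ a, BMS.D (BMS.weight h₁ h₂ c₁ c₂) (N / 2) a a =
      BMS.diagEntry h₂ c₂ (BMS.label (N / 2) a) := fun a => BMS.form_vec_star_self h₁ h₂ c₁ c₂ _
  refine ⟨BMS.isHarishChandra_harishChandra, htri, hdiag, ?_⟩
  rw [Matrix.det_of_isLowerTriangular _ fun a b h => htri a b h]
  exact Finset.prod_congr rfl fun a _ => hdiag a
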